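/- Let $A$ be a finite alphabet and $\tau\colon A\to A^+$ a substitution of constant length $p\ge 2$ (that is, $|\tau(a)|=p$ for all $a\in A$; $\tau$ is extended to words by concatenation). Assume that $\tau$ is one-to-one ($\tau(a)\neq\tau(b)$ for letters $a\neq b$) and primitive (there is $n\in\mathbb N=\{0,1,2,\dots\}$ such that $a$ appears in $\tau^n(b)$ for all $a,b\in A$). Let $X_\tau\subseteq A^{\mathbb Z}$ be the smallest subshift (closed shift-invariant set) such that every word $\tau^n(a)$, $n\in\mathbb N$, $a\in A$, is a sub-word of some point of $X_\tau$; let $T$ be the shift $(x_i)_{i\in\mathbb Z}\mapsto(x_{i+1})_{i\in\mathbb Z}$ on $X_\tau$, and let $\varrho$ be any metric on $X_\tau$ inducing its topology (as a subspace of $A^{\mathbb Z}$ with the product of discrete topologies). Assume that $X_\tau$ is infinite. Then $(X_\tau,T)$ has a Li–Yorke pair, i.e. there are $x,y\in X_\tau$ with $$\limsup_{n\to\infty}\varrho(T^nx,T^ny)>0\quad\text{and}\quad\liminf_{n\to\infty}\varrho(T^nx,T^ny)=0,$$ if and only if there exist $m\in\mathbb N$, letters $a,b\in A$ with $a\neq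 b$, and (possibly empty) words $u,u',v,v'$ such that $$\tau^m(a)=uav,\qquad \tau^m(b)=u'bv',$$ $|u|=|u'|$, $|v|=|v'|$, $v\neq v'$, and $v$ coincides with $v'$ in at least one coordinate. -/

import Mathlib

open Filter Topology

/-! ### Words and substitutions

A substitution on the alphabet `A` is a map `τ : A → List A`; words are lists of letters. -/

/-- The extension of a substitution to words by concatenation. -/
def wordMap {A : Type*} (τ : A → List A) (w : List A) : List A := w.flatMap τ

/-- The word `τ ^ n (a)`, for a letter `a`. -/
def iterWord {A : Type*} (τ : A → List A) (n : ℕ) (a : A) : List A := (wordMap τ)^[n] [a]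

/-- Every letter has an image of length `p`. -/
def IsConstantLength {A : Type*} (τ : A → List A) (p : ℕ) : Prop := ∀ a, (τ a).length = p

/-- For some `n`, every letter `a` appears in every word `τ ^ n (b)`. -/
def IsPrimitiveSubst {A : Type*} (τ : A → List A) : Prop :=
  ∃ n : ℕ, ∀ a b : A, a ∈ iterWord τ n b

/-- Two words coincide in at least one coordinate. -/
def HasCoincidence {A : Type*} (v w : List A) : Prop :=
  ∃ (i : ℕ) (c : A), v[i]? = some c ∧ w[i]? = some c

/-! ### Two-sided subshifts -/

/-- The shift map `T`. -/
def shiftMap {A : Type*} (x : ℤ → A) : ℤ → A := fun i => x (i + 1)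

/-- The word `x_i x_{i+1} … x_{i+k-1}`. -/
def window {A : Type*} (x : ℤ → A) (i : ℤ) (k : ℕ) : List A :=
  List.ofFn (fun j : Fin k => x (i + (j : ℕ)))

/-- A subshift: a closed shift-invariant set of two-sided sequences. -/
def IsSubshift {A : Type*} [TopologicalSpace A] (Y : Set (ℤ → A)) : Prop :=
  IsClosed Y ∧ shiftMap '' Y = Y

/-- The word `w` is a sub-word of some point of `Y`. -/
def Admits {A : Type*} (Y : Set (ℤ → A)) (w : List A) : Prop :=
  ∃ x ∈ Y, ∃ i : ℤ, window x i w.length = w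

/-- The subshift `X_τ`: the smallest subshift admitting all the words `τ ^ n (a)`, built as the
intersection of all subshifts that admit them (see `substShift_isLeast`). -/
def substShift {A : Type*} [TopologicalSpace A] (τ : A → List A) : Set (ℤ → A) :=
  ⋂₀ {Y | IsSubshift Y ∧ ∀ (n : ℕ) (a : A), Admits Y (iterWord τ n a)}

theorem shiftMap_mem_substShift {A : Type*} [TopologicalSpace A] (τ : A → List A) :
    Set.MapsTo shiftMap (substShift τ) (substShift τ) := by
  intro x hx Y hY
  rw [← hY.1.2]
  exact ⟨x, hx Y hY, rfl⟩

/-- The restriction of the shift map to `X_τ`. -/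
def substShiftMap {A : Type*} [TopologicalSpace A] (τ : A → List A) :
    substShift τ → substShift τ :=
  (shiftMap_mem_substShift τ).restrict

/-! ### Li–Yorke pairs -/

/-- `{x, y}` is a Li–Yorke pair of the system `(X, T)`: it is proximal but not asymptotic. -/
def IsLiYorkePair {X : Type*} [MetricSpace X] (T : X → X) (x y : X) : Prop :=
  0 < limsup (fun n : ℕ => dist (T^[n] x) (T^[n] y)) atTop ∧
    liminf (fun n : ℕ => dist (T^[n] x) (T^[n] y)) atTop = 0

/-! ### The subshift `X_τ` is well defined

For a primitive substitution of constant length at least two, the intersection `X_τ` is indeed the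
smallest subshift admitting all the words `τ ^ n (a)`, and it is the set of the sequences all of
whose sub-words are sub-words of these. -/

theorem wordMap_iter_append {A : Type*} (τ : A → List A) (n : ℕ) (u v : List A) :
    (wordMap τ)^[n] (u ++ v) = (wordMap τ)^[n] u ++ (wordMap τ)^[n] v := by
  induction n generalizing u v with
  | zero => rfl
  | succ n ih =>
    simp only [Function.iterate_succ, Function.comp]
    rw [show wordMap τ (u ++ v) = wordMap τ u ++ wordMap τ v from List.flatMap_append, ih]

theorem wordMap_iter_length {A : Type*} {τ : A → List A} {p : ℕ} (h : IsConstantLength τ p)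
    (n : ℕ) (w : List A) : ((wordMap τ)^[n] w).length = p ^ n * w.length := by
  induction n generalizing w with
  | zero => simp
  | succ n ih =>
    have h1 : (wordMap τ w).length = p * w.length := by
      induction w with
      | nil => simp [wordMap]
      | cons a w ihw =>
        have : wordMap τ (a :: w) = τ a ++ wordMap τ w := by simp [wordMap]
        rw [this, List.length_append, ihw, h a, List.length_cons]
        ring
    rw [Function.iterate_succ_apply, ih, h1, pow_succ]
    ring

theorem exists_mem_iterWord {A : Type*} {τ : A → List A} {p : ℕ} (h : IsConstantLength τ p)
    (hp : 2 ≤ p) (hprim : IsPrimitiveSubst τ) (K n : ℕ) (a : A) :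
    ∃ (N : ℕ) (b : A) (u v : List A), K ≤ u.length ∧ K ≤ v.length ∧
      iterWord τ N b = u ++ iterWord τ n a ++ v := by
  obtain ⟨M, hM⟩ := hprim
  have hlen : ((wordMap τ)^[2] [a]).length = p ^ 2 * 1 := wordMap_iter_length h 2 [a]
  obtain ⟨c0, c, c2, r, hr⟩ : ∃ c0 c c2 r, (wordMap τ)^[2] [a] = c0 :: c :: c2 :: r := by
    have h3 : 3 ≤ ((wordMap τ)^[2] [a]).length := by rw [hlen]; nlinarith
    match hw : (wordMap τ)^[2] [a], h3 with
    | c0 :: c :: c2 :: r, _ => exact ⟨c0, c, c2, r, rfl⟩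
  have hK : ∀ k : ℕ, k ≤ p ^ k := fun k => (Nat.lt_pow_self (by omega)).le
  have ha : a ∈ (wordMap τ)^[M + K] [c] := by
    rw [Function.iterate_add_apply]
    have hl : 1 ≤ ((wordMap τ)^[K] [c]).length := by
      rw [wordMap_iter_length h]
      simpa using Nat.one_le_pow _ _ (by omega)
    match hw : (wordMap τ)^[K] [c], hl with
    | d :: t, _ =>
      rw [show d :: t = [d] ++ t from rfl, wordMap_iter_append]
      exact List.mem_append_left _ (hM a d)
  obtain ⟨s, t, hst⟩ := List.append_of_mem ha
  refine ⟨n + (M + K) + 2, a, (wordMap τ)^[n + (M + K)] [c0] ++ (wordMap τ)^[n] s,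
    (wordMap τ)^[n] t ++ (wordMap τ)^[n + (M + K)] (c2 :: r), ?_, ?_, ?_⟩
  · rw [List.length_append, wordMap_iter_length h]
    have := hK (n + (M + K))
    simp only [List.length_singleton]
    omega
  · rw [List.length_append, wordMap_iter_length h (n + (M + K))]
    have := hK (n + (M + K))
    simp only [List.length_cons]
    nlinarith [Nat.zero_le (p ^ (n + (M + K)) * r.length)]
  · have h1 : iterWord τ (n + (M + K) + 2) a
        = (wordMap τ)^[n + (M + K)] ([c0] ++ [c] ++ (c2 :: r)) := by
      rw [iterWord, Function.iterate_add_apply, hr]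
      rfl
    have h2 : (wordMap τ)^[n + (M + K)] [c]
        = (wordMap τ)^[n] s ++ iterWord τ n a ++ (wordMap τ)^[n] t := by
      rw [Function.iterate_add_apply, hst, show s ++ a :: t = s ++ [a] ++ t by simp,
        wordMap_iter_append, wordMap_iter_append]
      rfl
    rw [h1, wordMap_iter_append, wordMap_iter_append, h2]
    simp only [List.append_assoc]

theorem window_length {A : Type*} (x : ℤ → A) (i : ℤ) (k : ℕ) : (window x i k).length = k := by
  simp [window]

theorem window_eq_iff {A : Type*} (x : ℤ → A) (i : ℤ) (k : ℕ) (w : List A) (hw : w.length = k) :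
    window x i k = w ↔ ∀ j : ℕ, j < k → w[j]? = some (x (i + j)) := by
  constructor
  · rintro rfl j hj
    simp [window, hj]
  · intro h
    apply List.ext_getElem?
    intro j
    by_cases hj : j < k
    · rw [h j hj]
      simp [window, hj]
    · rw [List.getElem?_eq_none (by rw [window_length]; omega),
        List.getElem?_eq_none (by omega)]

theorem isClosed_window {A : Type*} [TopologicalSpace A] [DiscreteTopology A]
    (S : Set (List A)) (i : ℤ) (k : ℕ) : IsClosed {x : ℤ → A | window x i k ∈ S} := by
  have hc : Continuous (fun (x : ℤ → A) (j : Fin k) => x (i + (j : ℕ))) := by fun_prop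
  exact (isClosed_discrete {f : Fin k → A | List.ofFn f ∈ S}).preimage hc

theorem IsSubshift.translate_mem {A : Type*} [TopologicalSpace A] {Y : Set (ℤ → A)}
    (hY : IsSubshift Y) (z : ℤ) : ∀ y ∈ Y, (fun i => y (i + z)) ∈ Y := by
  induction z using Int.induction_on with
  | zero => simp
  | succ n ih =>
    intro y hy
    have h1 : shiftMap (fun i => y (i + (n : ℤ))) ∈ Y := by
      rw [← hY.2]
      exact ⟨_, ih y hy, rfl⟩
    convert h1 using 1
    funext i
    simp only [shiftMap]
    congr 1
    ring
  | pred n ih =>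
    intro y hy
    have h1 := ih y hy
    rw [← hY.2] at h1
    obtain ⟨y', hy', he⟩ := h1
    convert hy' using 1
    funext i
    have := congrFun he (i - 1)
    simp only [shiftMap] at this
    rw [show i - 1 + 1 = i by ring] at this
    rw [this]
    congr 1
    ring

/-- The sequences all of whose sub-words are sub-words of the words `τ ^ n (a)` form the smallest
subshift admitting all these words. -/
theorem isLeast_language {A : Type*} [Finite A] [TopologicalSpace A] [DiscreteTopology A]
    {τ : A → List A} {p : ℕ} (h : IsConstantLength τ p) (hp : 2 ≤ p)
    (hprim : IsPrimitiveSubst τ) :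
    IsLeast {Y | IsSubshift Y ∧ ∀ (n : ℕ) (a : A), Admits Y (iterWord τ n a)}
      {x : ℤ → A | ∀ (i : ℤ) (k : ℕ), ∃ (n : ℕ) (a : A), window x i k <:+: iterWord τ n a} := by
  refine ⟨⟨⟨?_, ?_⟩, ?_⟩, ?_⟩
  · simp only [Set.ofPred_forall]
    exact isClosed_iInter fun i => isClosed_iInter fun k =>
      isClosed_window {w | ∃ (n : ℕ) (a : A), w <:+: iterWord τ n a} i k
  · have hw : ∀ (x : ℤ → A) (z i : ℤ) (k : ℕ),
        window (fun j => x (j + z)) i k = window x (i + z) k := by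
      intro x z i k
      simp only [window]
      congr 1
      funext j
      congr 1
      ring
    apply Set.Subset.antisymm
    · rintro _ ⟨x, hx, rfl⟩ i k
      have := hx (i + 1) k
      rwa [← hw] at this
    · intro x hx
      refine ⟨fun j => x (j + (-1)), fun i k => ?_, ?_⟩
      · rw [hw]
        exact hx _ k
      · funext j
        simp [shiftMap]
  · intro n a
    set w := iterWord τ n a with hwdef
    let C : ℕ → Set (ℤ → A) := fun K => {x | window x 0 w.length ∈ ({w} : Set (List A))} ∩
      {x | ∀ (i : ℤ) (k : ℕ), -(K : ℤ) ≤ i → i + k ≤ w.length + K →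
        window x i k ∈ {v | ∃ (n : ℕ) (a : A), v <:+: iterWord τ n a}}
    have hcl : ∀ K, IsClosed (C K) := by
      intro K
      refine (isClosed_window _ _ _).inter ?_
      simp only [Set.ofPred_forall]
      exact isClosed_iInter fun i => isClosed_iInter fun k => isClosed_iInter fun _ =>
        isClosed_iInter fun _ => isClosed_window _ i k
    have hne : ∀ K, (C K).Nonempty := by
      intro K
      obtain ⟨N, b, u, v, hu, hv, huv⟩ := exists_mem_iterWord h hp hprim K n a
      rw [← hwdef] at huv
      let z : ℤ → A := fun i => (u ++ w ++ v).getD (i + u.length).toNat a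
      have hz : ∀ (i : ℤ) (k : ℕ), -(u.length : ℤ) ≤ i → i + k ≤ w.length + v.length →
          window z i k = ((u ++ w ++ v).drop (i + u.length).toNat).take k := by
        intro i k hi hk
        rw [window_eq_iff]
        · intro j hj
          rw [List.getElem?_take_of_lt hj, List.getElem?_drop]
          have e : (i + (j : ℤ) + u.length).toNat = (i + u.length).toNat + j := by omega
          have hlt : (i + u.length).toNat + j < (u ++ w ++ v).length := by
            simp only [List.length_append]
            omega
          simp only [z, e]
          rw [List.getD_eq_getElem _ _ hlt, List.getElem?_eq_getElem hlt]
        · simp only [List.length_take, List.length_drop, List.length_append]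
          omega
      refine ⟨z, ?_, ?_⟩
      · change window z 0 w.length = w
        rw [hz _ _ (by omega) (by omega)]
        simp
      · intro i k hi hk
        refine ⟨N, b, ?_⟩
        rw [hz _ _ (by omega) (by omega), huv]
        exact (List.take_prefix _ _).isInfix.trans (List.drop_suffix _ _).isInfix
    have hmono : ∀ K, C (K + 1) ⊆ C K := by
      rintro K x ⟨h1, h2⟩
      refine ⟨h1, fun i k hi hk => h2 i k ?_ ?_⟩ <;> push_cast <;> omega
    obtain ⟨x, hx⟩ := IsCompact.nonempty_iInter_of_sequence_nonempty_isCompact_isClosed C hmono hne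
      (hcl 0).isCompact hcl
    rw [Set.mem_iInter] at hx
    refine ⟨x, fun i k => ?_, 0, (hx 0).1⟩
    exact (hx (i.natAbs + k)).2 i k (by omega) (by omega)
  · rintro Y ⟨hY, hadm⟩ x hx
    have key : ∀ K : ℕ, ∃ y ∈ Y, ∀ i : ℤ, -(K : ℤ) ≤ i → i ≤ K → y i = x i := by
      intro K
      obtain ⟨n, a, s, t, hst⟩ := hx (-(K : ℤ)) (2 * K + 1)
      obtain ⟨y, hy, i, hi⟩ := hadm n a
      refine ⟨fun j => y (j + (i + s.length + K)), hY.translate_mem _ y hy, fun j hj1 hj2 => ?_⟩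
      rw [window_eq_iff _ _ _ _ rfl] at hi
      have hlen : (iterWord τ n a).length = s.length + (2 * K + 1) + t.length := by
        rw [← hst]
        simp only [List.length_append, window_length]
      have h1 := hi (s.length + (j + K).toNat) (by omega)
      have h2 := (window_eq_iff x (-(K : ℤ)) (2 * K + 1) _ (window_length _ _ _)).1 rfl
        (j + K).toNat (by omega)
      rw [← hst, List.append_assoc, List.getElem?_append_right (by omega),
        List.getElem?_append_left (by rw [window_length]; omega), Nat.add_sub_cancel_left, h2] at h1
      have h3 := Option.some.inj h1
      rw [show -(K : ℤ) + ((j + K).toNat : ℤ) = j by omega] at h3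
      rw [h3]
      change y (j + (i + s.length + K)) = _
      congr 1
      omega
    choose y hyY hyx using key
    refine hY.1.mem_of_tendsto (f := y) (b := atTop) ?_ (Eventually.of_forall hyY)
    rw [tendsto_pi_nhds]
    intro i
    refine tendsto_const_nhds.congr' ?_
    filter_upwards [eventually_ge_atTop i.natAbs] with K hK
    exact (hyx K i (by omega) (by omega)).symm

theorem substShift_isLeast {A : Type*} [Finite A] [TopologicalSpace A] [DiscreteTopology A]
    {τ : A → List A} {p : ℕ} (h : IsConstantLength τ p) (hp : 2 ≤ p)
    (hprim : IsPrimitiveSubst τ) :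
    IsLeast {Y | IsSubshift Y ∧ ∀ (n : ℕ) (a : A), Admits Y (iterWord τ n a)}
      (substShift τ) := by
  have h1 := isLeast_language h hp hprim
  rwa [show substShift τ = _ from h1.isGLB.sInf_eq]

theorem mem_substShift_iff {A : Type*} [Finite A] [TopologicalSpace A] [DiscreteTopology A]
    {τ : A → List A} {p : ℕ} (h : IsConstantLength τ p) (hp : 2 ≤ p)
    (hprim : IsPrimitiveSubst τ) (x : ℤ → A) :
    x ∈ substShift τ ↔
      ∀ (i : ℤ) (k : ℕ), ∃ (n : ℕ) (a : A), window x i k <:+: iterWord τ n a := by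
  rw [show substShift τ = _ from (isLeast_language h hp hprim).isGLB.sInf_eq]
  rfl

/-! By compactness, a Li–Yorke pair is a pair x, y in X_τ that differs at arbitrarily large
coordinates and agrees on arbitrarily long windows arbitrarily far to the right
(`isLiYorkePair_iff_agree_differ`). The metric plays no further role.

From a pair to words. Every point can be desubstituted indefinitely: x = T^{J_k} τ^k(Z_k) with Z_k
in X_τ, where J_k has k digits in base p. Two such points with arbitrarily long common words have
the same digits (`IsDesubst.digits_eq`). Otherwise compactness and minimality make the difference of
the two offsets modulo p^n, hence its gcd d with p^n, a translation preserving τ^n(X_τ), with p^n /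
d unbounded. Pigeonhole then gives some τ^n(c) a period small compared with p^n; since τ^n(c)
contains the images of all two-letter words under a fixed lower power of τ, the whole of X_τ is
periodic, hence finite. With common offsets, x and y are cut into level-k blocks at the same places.
One block index β, equal to 0 or 1, covers any given bounded part of a right half-line at all high
levels (`exists_block_covering`). Some pair (a, b) is the pair of letters at β for infinitely many
k. Comparing two such levels k₁ < k₁ + m, the block at β of the higher level contains, at level k₁,
the pair (a, b) itself and, to its right, a coincidence and a discrepancy: this is the word
condition. Injectivity of τ makes agreement on a full block descend to its letter.

From words to a pair. With r = |u|, the map T^r τ^m preserves the letters a and b at the origin.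
Each application recreates the coincidence and the discrepancy to the right of the origin, and
pushes the earlier ones outward, at least doubling the runs of agreement. A pair with ancestors of
every order under this map is the desired one (`exists_agree_differ_of_pair`). -/

/-- The letter of index `i` of `τ ^ n (a)`. -/
def letterAt {A : Type*} (τ : A → List A) (n : ℕ) (a : A) (i : ℕ) : A :=
  (iterWord τ n a).getD i a

/-- The extension of `τ ^ n` to two-sided sequences, for `τ` of constant length `p`. -/
def inflate {A : Type*} (τ : A → List A) (p n : ℕ) (x : ℤ → A) : ℤ → A :=
  fun i => letterAt τ n (x (i / (p : ℤ) ^ n)) (i % (p : ℤ) ^ n).toNat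

/-! ### Letters of iterated words -/

section Words

variable {A : Type*} {τ : A → List A} {p : ℕ}

theorem iterWord_length (h : IsConstantLength τ p) (n : ℕ) (a : A) :
    (iterWord τ n a).length = p ^ n := by
  rw [iterWord, wordMap_iter_length h]; simp

/-- Within this range the default value of `getD` in `letterAt` is never read. -/
theorem iterWord_getElem? (h : IsConstantLength τ p) {n : ℕ} {a : A} {i : ℕ} (hi : i < p ^ n) :
    (iterWord τ n a)[i]? = some (letterAt τ n a i) := by
  have hl : i < (iterWord τ n a).length := by rwa [iterWord_length h]
  rw [letterAt, List.getD_eq_getElem _ _ hl, List.getElem?_eq_getElem hl]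

theorem wordMap_iter_getElem? (h : IsConstantLength τ p) (n : ℕ) (w : List A) (q r : ℕ)
    (hr : r < p ^ n) (b : A) (hb : w[q]? = some b) :
    ((wordMap τ)^[n] w)[q * p ^ n + r]? = some (letterAt τ n b r) := by
  induction w generalizing q with
  | nil => simp at hb
  | cons c w ih =>
    have e : (wordMap τ)^[n] (c :: w) = iterWord τ n c ++ (wordMap τ)^[n] w := by
      rw [show c :: w = [c] ++ w from rfl, wordMap_iter_append]; rfl
    rw [e]
    cases q with
    | zero =>
      simp only [List.getElem?_cons_zero, Option.some.injEq] at hb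
      subst hb
      rw [List.getElem?_append_left (by rw [iterWord_length h]; omega), zero_mul, zero_add,
        iterWord_getElem? h hr]
    | succ q =>
      rw [List.getElem?_append_right (by rw [iterWord_length h]; nlinarith), iterWord_length h,
        show (q + 1) * p ^ n + r - p ^ n = q * p ^ n + r by
          rw [add_mul, one_mul]; omega]
      exact ih q (by simpa using hb)

theorem iterWord_add (m n : ℕ) (a : A) :
    iterWord τ (m + n) a = (wordMap τ)^[m] (iterWord τ n a) := by
  rw [iterWord, Function.iterate_add_apply]; rfl

theorem letterAt_add (h : IsConstantLength τ p) {m n q r : ℕ} (a : A) (hq : q < p ^ n)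
    (hr : r < p ^ m) :
    letterAt τ (m + n) a (q * p ^ m + r) = letterAt τ m (letterAt τ n a q) r := by
  have h1 := wordMap_iter_getElem? h m (iterWord τ n a) q r hr _ (iterWord_getElem? h hq)
  rw [← iterWord_add, iterWord_getElem? h] at h1
  · exact Option.some.inj h1
  · rw [pow_add]
    calc q * p ^ m + r < q * p ^ m + p ^ m := by omega
      _ = (q + 1) * p ^ m := by ring
      _ ≤ p ^ n * p ^ m := Nat.mul_le_mul_right _ hq
      _ = _ := by ring

theorem wordMap_injective (h : IsConstantLength τ p) (hp : 0 < p)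
    (hinj : Function.Injective τ) : Function.Injective (wordMap τ) := by
  have hcons : ∀ a w, wordMap τ (a :: w) = τ a ++ wordMap τ w := fun a w => by simp [wordMap]
  intro u
  induction u with
  | nil =>
    rintro (_ | ⟨b, v⟩) huv
    · rfl
    · have := congrArg List.length huv
      rw [hcons, List.length_append, h b] at this
      simp [wordMap] at this
      omega
  | cons a u ih =>
    rintro (_ | ⟨b, v⟩) huv
    · have := congrArg List.length huv
      rw [hcons, List.length_append, h a] at this
      simp [wordMap] at this
      omega
    · rw [hcons, hcons] at huv
      obtain ⟨h1, h2⟩ := List.append_inj huv (by rw [h a, h b])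
      rw [hinj h1, ih h2]

theorem iterWord_injective (h : IsConstantLength τ p) (hp : 0 < p)
    (hinj : Function.Injective τ) (n : ℕ) : Function.Injective (iterWord τ n) := by
  intro a b hab
  simpa using (wordMap_injective h hp hinj).iterate n hab

theorem eq_of_letterAt_eq (h : IsConstantLength τ p) (hp : 0 < p) (hinj : Function.Injective τ)
    {n : ℕ} {a b : A} (hab : ∀ i < p ^ n, letterAt τ n a i = letterAt τ n b i) : a = b := by
  apply iterWord_injective h hp hinj n
  apply List.ext_getElem?
  intro i
  by_cases hi : i < p ^ n
  · rw [iterWord_getElem? h hi, iterWord_getElem? h hi, hab i hi]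
  · rw [List.getElem?_eq_none (by rw [iterWord_length h]; omega),
      List.getElem?_eq_none (by rw [iterWord_length h]; omega)]

theorem iterWord_infix_of_infix {w : List A} {n : ℕ} {a b : A} {N : ℕ}
    (hw : w <:+: iterWord τ n a) (ha : a ∈ iterWord τ N b) : w <:+: iterWord τ (n + N) b := by
  obtain ⟨s, t, hst⟩ := List.append_of_mem ha
  refine hw.trans ⟨(wordMap τ)^[n] s, (wordMap τ)^[n] t, ?_⟩
  rw [iterWord_add, hst, show s ++ a :: t = s ++ [a] ++ t by simp, wordMap_iter_append,
    wordMap_iter_append]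
  rfl

/-- Beyond some exponent, every letter appears in all the words `τ ^ n (b)`. -/
theorem exists_forall_mem_iterWord (h : IsConstantLength τ p) (hp : 0 < p)
    (hprim : IsPrimitiveSubst τ) : ∃ M : ℕ, ∀ n ≥ M, ∀ a b : A, a ∈ iterWord τ n b := by
  obtain ⟨M, hM⟩ := hprim
  refine ⟨M, fun n hn a b => ?_⟩
  obtain ⟨k, rfl⟩ := Nat.exists_eq_add_of_le hn
  have hl : 0 < (iterWord τ k b).length := by rw [iterWord_length h]; positivity
  obtain ⟨d, hd⟩ := List.exists_mem_of_length_pos hl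
  have h1 := iterWord_infix_of_infix (List.infix_refl (iterWord τ M d)) hd
  exact h1.subset (hM a d)

end Words

/-! ### The substitution acting on two-sided sequences -/

section Inflate

variable {A : Type*} {τ : A → List A} {p : ℕ}

/-- Integer division rounds down here, so the blocks are aligned at negative coordinates too. -/
theorem inflate_mul_add (hp : 0 < p) (n : ℕ) (x : ℤ → A) (q : ℤ) {t : ℕ} (ht : t < p ^ n) :
    inflate τ p n x (q * (p : ℤ) ^ n + t) = letterAt τ n (x q) t := by
  have hP : (0 : ℤ) < (p : ℤ) ^ n := by positivity
  have ht' : (t : ℤ) < (p : ℤ) ^ n := by exact_mod_cast ht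
  have h1 : (q * (p : ℤ) ^ n + t) / (p : ℤ) ^ n = q := by
    rw [add_comm, Int.add_mul_ediv_right _ _ hP.ne', Int.ediv_eq_zero_of_lt (by omega) ht']; simp
  have h2 : (q * (p : ℤ) ^ n + t) % (p : ℤ) ^ n = t := by
    rw [add_comm, Int.add_mul_emod_self_right, Int.emod_eq_of_lt (by omega) ht']
  rw [inflate, h1, h2, Int.toNat_natCast]

/-- Euclidean division of an integer by `p ^ n`. -/
theorem exists_eq_mul_pow_add (hp : 0 < p) (n : ℕ) (i : ℤ) :
    ∃ (q : ℤ) (t : ℕ), t < p ^ n ∧ i = q * (p : ℤ) ^ n + t := by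
  have hP : (0 : ℤ) < (p : ℤ) ^ n := by positivity
  have h1 := Int.emod_nonneg i hP.ne'
  have h2 := Int.emod_lt_of_pos i hP
  refine ⟨i / (p : ℤ) ^ n, (i % (p : ℤ) ^ n).toNat, ?_, ?_⟩
  · have : ((i % (p : ℤ) ^ n).toNat : ℤ) < ((p ^ n : ℕ) : ℤ) := by push_cast; omega
    exact_mod_cast this
  · rw [Int.toNat_of_nonneg h1]
    linarith [Int.emod_add_mul_ediv i ((p : ℤ) ^ n), mul_comm ((p : ℤ) ^ n) (i / (p : ℤ) ^ n)]

theorem inflate_zero (x : ℤ → A) : inflate τ p 0 x = x := by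
  funext i
  simp [inflate, letterAt, iterWord]

theorem inflate_shift (hp : 0 < p) (n : ℕ) (x : ℤ → A) (k i : ℤ) :
    inflate τ p n (fun j => x (j + k)) i = inflate τ p n x (i + k * (p : ℤ) ^ n) := by
  obtain ⟨q, t, ht, rfl⟩ := exists_eq_mul_pow_add hp n i
  rw [inflate_mul_add hp _ _ _ ht,
    show q * (p : ℤ) ^ n + t + k * (p : ℤ) ^ n = (q + k) * (p : ℤ) ^ n + t by ring,
    inflate_mul_add hp _ _ _ ht]

theorem inflate_add (h : IsConstantLength τ p) (hp : 0 < p) (m n : ℕ) (x : ℤ → A) :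
    inflate τ p (m + n) x = inflate τ p m (inflate τ p n x) := by
  funext i
  obtain ⟨q, t, ht, rfl⟩ := exists_eq_mul_pow_add hp m i
  obtain ⟨q', t', ht', rfl⟩ := exists_eq_mul_pow_add hp n q
  rw [inflate_mul_add hp _ _ _ ht, inflate_mul_add hp _ _ _ ht',
    show (q' * (p : ℤ) ^ n + t') * (p : ℤ) ^ m + t
      = q' * (p : ℤ) ^ (m + n) + ((t' * p ^ m + t : ℕ) : ℤ) by push_cast; ring,
    inflate_mul_add hp, letterAt_add h _ ht' ht]
  rw [pow_add]
  calc t' * p ^ m + t < t' * p ^ m + p ^ m := by omega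
    _ = (t' + 1) * p ^ m := by ring
    _ ≤ p ^ n * p ^ m := Nat.mul_le_mul_right _ ht'
    _ = _ := by ring

theorem window_inflate (h : IsConstantLength τ p) (hp : 0 < p) (n : ℕ) (x : ℤ → A) (i : ℤ)
    (w : List A) (hw : window x i w.length = w) :
    window (inflate τ p n x) (i * (p : ℤ) ^ n) ((wordMap τ)^[n] w).length
      = (wordMap τ)^[n] w := by
  rw [window_eq_iff _ _ _ _ rfl] at hw ⊢
  intro j hj
  rw [wordMap_iter_length h] at hj
  have hP : 0 < p ^ n := by positivity
  have hq : j / p ^ n < w.length := Nat.div_lt_of_lt_mul hj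
  have hr := Nat.mod_lt j hP
  have e : j = j / p ^ n * p ^ n + j % p ^ n := by rw [mul_comm]; exact (Nat.div_add_mod _ _).symm
  have h1 := wordMap_iter_getElem? h n w _ _ hr _ (hw _ hq)
  rw [← e] at h1
  rw [h1, ← inflate_mul_add hp n x _ hr]
  congr 2
  conv_rhs => rw [e]
  push_cast
  ring

theorem continuous_inflate [TopologicalSpace A] [DiscreteTopology A] (n : ℕ) :
    Continuous (inflate τ p n) := by
  refine continuous_pi fun i => ?_
  exact (continuous_of_discreteTopology (f := fun a => letterAt τ n a (i % (p : ℤ) ^ n).toNat)).comp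
    (continuous_apply _)

end Inflate

/-! ### Sub-words and windows -/

section Windows

variable {A : Type*}

theorem Admits.of_infix {Y : Set (ℤ → A)} {v w : List A} (hw : Admits Y w) (hv : v <:+: w) :
    Admits Y v := by
  obtain ⟨x, hx, i, hi⟩ := hw
  obtain ⟨s, t, rfl⟩ := hv
  refine ⟨x, hx, i + s.length, ?_⟩
  rw [window_eq_iff _ _ _ _ rfl] at hi ⊢
  intro j hj
  have := hi (s.length + j) (by simp; omega)
  rw [List.append_assoc, List.getElem?_append_right (by omega), Nat.add_sub_cancel_left,
    List.getElem?_append_left hj] at this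
  rw [this]
  congr 2
  push_cast
  ring

theorem window_infix_window (x : ℤ → A) {i i' : ℤ} {k k' : ℕ} (h1 : i' ≤ i)
    (h2 : i + k ≤ i' + k') : window x i k <:+: window x i' k' := by
  have h3 : window x i k = ((window x i' k').drop (i - i').toNat).take k := by
    rw [window_eq_iff]
    · intro j hj
      rw [List.getElem?_take_of_lt hj, List.getElem?_drop,
        (window_eq_iff x i' k' _ (window_length _ _ _)).1 rfl _ (by omega)]
      congr 2
      push_cast
      omega
    · rw [List.length_take, List.length_drop, window_length]
      omega
  rw [h3]
  exact (List.take_prefix _ _).isInfix.trans (List.drop_suffix _ _).isInfix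

end Windows

/-! ### Desubstitution and minimality of the subshift -/

section SubstShift

variable {A : Type*} [Finite A] [TopologicalSpace A] [DiscreteTopology A] {τ : A → List A} {p : ℕ}

theorem isCompact_substShift (h : IsConstantLength τ p) (hp : 2 ≤ p)
    (hprim : IsPrimitiveSubst τ) : IsCompact (substShift τ) :=
  (substShift_isLeast h hp hprim).1.1.1.isCompact

theorem translate_mem_substShift (h : IsConstantLength τ p) (hp : 2 ≤ p)
    (hprim : IsPrimitiveSubst τ) {x : ℤ → A} (hx : x ∈ substShift τ) (z : ℤ) :
    (fun i => x (i + z)) ∈ substShift τ :=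
  (substShift_isLeast h hp hprim).1.1.translate_mem z x hx

theorem inflate_mem_substShift (h : IsConstantLength τ p) (hp : 2 ≤ p)
    (hprim : IsPrimitiveSubst τ) {x : ℤ → A} (hx : x ∈ substShift τ) (n : ℕ) :
    inflate τ p n x ∈ substShift τ := by
  have hp0 : 0 < p := by omega
  have hP : (1 : ℤ) ≤ (p : ℤ) ^ n := by exact_mod_cast Nat.one_le_pow _ _ hp0
  rw [mem_substShift_iff h hp hprim] at hx ⊢
  intro i k
  -- As p ^ n ≥ 1, the image of this window around the origin covers the coordinates from i to i +
  -- k.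
  obtain ⟨N, a, s, t, hst⟩ := hx (-(i.natAbs : ℤ)) (2 * i.natAbs + k)
  refine ⟨n + N, a, ?_⟩
  have h1 := window_inflate h hp0 n x _ (window x (-(i.natAbs : ℤ)) (2 * i.natAbs + k))
    (by rw [window_length])
  have h2 : (wordMap τ)^[n] (window x (-(i.natAbs : ℤ)) (2 * i.natAbs + k))
      <:+: iterWord τ (n + N) a := by
    rw [iterWord_add, ← hst, wordMap_iter_append, wordMap_iter_append]
    exact List.infix_append _ _ _
  refine List.IsInfix.trans ?_ h2
  rw [← h1, wordMap_iter_length h, window_length]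
  apply window_infix_window
  · have : (i.natAbs : ℤ) * 1 ≤ (i.natAbs : ℤ) * (p : ℤ) ^ n :=
      mul_le_mul_of_nonneg_left hP (by omega)
    rw [neg_mul]
    omega
  · push_cast
    have : (|i| + k) * 1 ≤ (|i| + k) * (p : ℤ) ^ n :=
      mul_le_mul_of_nonneg_left hP (by positivity)
    have := le_abs_self i
    linarith

/-- Every point of `X_τ` is a translate of `τ ^ n (y)` with `y` in `X_τ`. -/
theorem exists_inflate_shift_eq (h : IsConstantLength τ p) (hp : 2 ≤ p)
    (hprim : IsPrimitiveSubst τ) (n : ℕ) {x : ℤ → A} (hx : x ∈ substShift τ) :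
    ∃ y ∈ substShift τ, ∃ r < p ^ n, ∀ i, x i = inflate τ p n y (i + (r : ℕ)) := by
  have hp0 : 0 < p := by omega
  have hP : 0 < p ^ n := by positivity
  let f : ℕ → (ℤ → A) → (ℤ → A) := fun r y i => inflate τ p n y (i + r)
  have hf : ∀ r, Continuous (f r) := fun r => by
    refine continuous_pi fun i => (continuous_apply (i + (r : ℤ))).comp (continuous_inflate n)
  -- The points of the desired form make up a subshift admitting all the words τ ^ m (a), so it
  -- contains X_τ by leastness.
  let Y : Set (ℤ → A) := ⋃ r ∈ Finset.range (p ^ n), f r '' substShift τ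
  have hYmem : ∀ z, z ∈ Y ↔ ∃ r < p ^ n, ∃ y ∈ substShift τ, f r y = z := by
    intro z; simp [Y]
  have hcl : IsClosed Y :=
    ((Finset.range (p ^ n)).isCompact_biUnion fun r _ =>
      (isCompact_substShift h hp hprim).image (hf r)).isClosed
  have htr : ∀ (z : ℤ), ∀ w ∈ Y, (fun i => w (i + z)) ∈ Y := by
    intro z w hw
    rw [hYmem] at hw ⊢
    obtain ⟨r, -, y, hy, rfl⟩ := hw
    -- The offset is reduced modulo p ^ n; the carry q is absorbed by translating y.
    obtain ⟨q, t, ht, hqt⟩ := exists_eq_mul_pow_add hp0 n (z + r)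
    refine ⟨t, ht, _, translate_mem_substShift h hp hprim hy q, ?_⟩
    funext i
    simp only [f]
    rw [inflate_shift hp0]
    congr 1
    linarith
  have hsub : IsSubshift Y := by
    refine ⟨hcl, Set.Subset.antisymm ?_ ?_⟩
    · rintro _ ⟨w, hw, rfl⟩
      exact htr 1 w hw
    · intro w hw
      refine ⟨_, htr (-1) w hw, ?_⟩
      funext i
      simp [shiftMap]
  have hadm : ∀ (m : ℕ) (a : A), Admits Y (iterWord τ m a) := by
    intro m a
    obtain ⟨M, hM⟩ := exists_forall_mem_iterWord h hp0 hprim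
    obtain ⟨w, hw, i, hi⟩ := (substShift_isLeast h hp hprim).1.2 (m + M) a
    have h1 : Admits Y (iterWord τ (n + (m + M)) a) := by
      refine ⟨f 0 w, (hYmem _).2 ⟨0, hP, w, hw, rfl⟩, i * (p : ℤ) ^ n, ?_⟩
      have := window_inflate h hp0 n w i _ hi
      rw [← iterWord_add] at this
      simpa [f] using this
    refine h1.of_infix ?_
    rw [show n + (m + M) = m + (M + n) by ring]
    exact iterWord_infix_of_infix (List.infix_refl _) (hM _ (by omega) a a)
  have hxY : x ∈ Y := Set.mem_sInter.1 hx Y ⟨hsub, hadm⟩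
  obtain ⟨r, hr, y, hy, rfl⟩ := (hYmem x).1 hxY
  exact ⟨y, hy, r, hr, fun i => rfl⟩

/-- `X_τ` is a minimal subshift. -/
theorem substShift_minimal (h : IsConstantLength τ p) (hp : 2 ≤ p)
    (hprim : IsPrimitiveSubst τ) {Y : Set (ℤ → A)} (hYX : Y ⊆ substShift τ) (hne : Y.Nonempty)
    (hY : IsSubshift Y) : substShift τ ⊆ Y := by
  have hp0 : 0 < p := by omega
  refine Set.sInter_subset_of_mem ⟨hY, fun n a => ?_⟩
  obtain ⟨M, hM⟩ := exists_forall_mem_iterWord h hp0 hprim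
  obtain ⟨y, hy⟩ := hne
  obtain ⟨z, -, r, -, hr⟩ := exists_inflate_shift_eq h hp hprim (n + M) (hYX hy)
  -- A point of Y contains a whole block of level n + M, and such a block contains τ ^ n (a) for
  -- every letter a.
  have h1 : Admits Y (iterWord τ (n + M) (z 0)) := by
    refine ⟨y, hy, -r, ?_⟩
    rw [window_eq_iff _ _ _ _ rfl]
    intro j hj
    rw [iterWord_length h] at hj
    rw [iterWord_getElem? h hj, hr, ← inflate_mul_add hp0 _ z 0 hj]
    congr 2
    ring
  exact h1.of_infix (iterWord_infix_of_infix (List.infix_refl _) (hM _ le_rfl _ _))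

/-- Every two-letter word of `X_τ` appears in every `τ ^ c (b)`, for a uniform exponent `c`. -/
theorem exists_letterAt_pair (h : IsConstantLength τ p) (hp : 2 ≤ p)
    (hprim : IsPrimitiveSubst τ) : ∃ c : ℕ, ∀ (b : A), ∀ y ∈ substShift τ,
      ∃ q, q + 1 < p ^ c ∧ letterAt τ c b q = y 0 ∧ letterAt τ c b (q + 1) = y 1 := by
  have hp0 : 0 < p := by omega
  obtain ⟨M, hM⟩ := exists_forall_mem_iterWord h hp0 hprim
  have key : ∀ s : A × A, ∃ N : ℕ, ∀ y ∈ substShift τ, y 0 = s.1 → y 1 = s.2 → ∀ n ≥ N, ∀ b,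
      [s.1, s.2] <:+: iterWord τ n b := by
    intro s
    by_cases hs : ∃ y ∈ substShift τ, y 0 = s.1 ∧ y 1 = s.2
    · obtain ⟨y, hy, h0, h1⟩ := hs
      obtain ⟨n, a, hna⟩ := (mem_substShift_iff h hp hprim y).1 hy 0 2
      have hw : window y 0 2 = [s.1, s.2] := by simp [window, h0, h1]
      rw [hw] at hna
      refine ⟨n + M, fun _ _ _ _ k hk b => ?_⟩
      obtain ⟨l, rfl⟩ := Nat.exists_eq_add_of_le hk
      rw [add_assoc]
      exact iterWord_infix_of_infix hna (hM _ (by omega) _ _)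
    · exact ⟨0, fun y hy h0 h1 => (hs ⟨y, hy, h0, h1⟩).elim⟩
  choose N hN using key
  cases nonempty_fintype A
  refine ⟨Finset.univ.sup N, fun b y hy => ?_⟩
  set c := Finset.univ.sup N
  obtain ⟨s, t, hst⟩ := hN (y 0, y 1) y hy rfl rfl c (Finset.le_sup (Finset.mem_univ _)) b
  have hl := congrArg List.length hst
  rw [iterWord_length h] at hl
  simp only [List.length_append, List.length_cons, List.length_nil] at hl
  refine ⟨s.length, by omega, ?_, ?_⟩
  · have := iterWord_getElem? (a := b) h (show s.length < p ^ c by omega)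
    rw [← hst] at this
    simpa using this.symm
  · have := iterWord_getElem? (a := b) h (show s.length + 1 < p ^ c by omega)
    rw [← hst] at this
    simpa using this.symm

end SubstShift

/-! ### Offsets in base p and divisibility -/

/-- The number with digits `r k, …, r (k + m - 1)` in base `p`. -/
def digitSum (p : ℕ) (r : ℕ → ℕ) (k m : ℕ) : ℕ := ∑ l ∈ Finset.range m, p ^ l * r (k + l)

/-- A sequence `Z` of successive desubstitutions in `X_τ`, with offsets `r`. -/
structure IsDesubst {A : Type*} [TopologicalSpace A] (τ : A → List A) (p : ℕ)
    (Z : ℕ → ℤ → A) (r : ℕ → ℕ) : Prop where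
  mem : ∀ k, Z k ∈ substShift τ
  lt : ∀ k, r k < p
  eq : ∀ k i, Z k i = inflate τ p 1 (Z (k + 1)) (i + (r k : ℕ))

section Digits

variable {p : ℕ} {r : ℕ → ℕ}

theorem digitSum_succ (k m : ℕ) :
    digitSum p r k (m + 1) = digitSum p r k m + p ^ m * r (k + m) := by
  rw [digitSum, Finset.sum_range_succ]; rfl

theorem digitSum_add (k l m : ℕ) :
    digitSum p r k (l + m) = digitSum p r k l + p ^ l * digitSum p r (k + l) m := by
  induction m with
  | zero => simp [digitSum]
  | succ m ih => rw [← add_assoc, digitSum_succ, ih, digitSum_succ, pow_add, ← add_assoc k]; ring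

theorem digitSum_lt (hr : ∀ k, r k < p) (k m : ℕ) : digitSum p r k m < p ^ m := by
  induction m with
  | zero => simp [digitSum]
  | succ m ih =>
    rw [digitSum_succ]
    calc digitSum p r k m + p ^ m * r (k + m) < p ^ m + p ^ m * r (k + m) := by omega
      _ = p ^ m * (r (k + m) + 1) := by ring
      _ ≤ p ^ m * p := Nat.mul_le_mul_left _ (hr _)
      _ = p ^ (m + 1) := by ring

/-- If two sequences of digits differ, their partial sums stay incongruent modulo some power. -/
theorem exists_not_dvd_digitSum_sub {s : ℕ → ℕ} (hp : 0 < p) (hr : ∀ k, r k < p)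
    (hs : ∀ k, s k < p) (hrs : r ≠ s) : ∃ K : ℕ, ∀ n ≥ K,
      ¬ (p : ℤ) ^ K ∣ (digitSum p r 0 n : ℤ) - digitSum p s 0 n := by
  obtain ⟨K, hK⟩ : ∃ K, digitSum p r 0 K ≠ digitSum p s 0 K := by
    by_contra! hall
    apply hrs
    funext k
    have h1 := hall (k + 1)
    rw [digitSum_succ, digitSum_succ, hall k, zero_add] at h1
    exact Nat.eq_of_mul_eq_mul_left (show 0 < p ^ k by positivity) (by omega)
  refine ⟨K, fun n hn hdvd => hK ?_⟩
  obtain ⟨l, rfl⟩ := Nat.exists_eq_add_of_le hn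
  have h1 : (p : ℤ) ^ K ∣ (digitSum p r 0 K : ℤ) - digitSum p s 0 K := by
    rw [digitSum_add, digitSum_add] at hdvd
    have h2 : (p : ℤ) ^ K ∣ (p : ℤ) ^ K *
      ((digitSum p r (0 + K) l : ℤ) - digitSum p s (0 + K) l) := dvd_mul_right _ _
    have h3 := dvd_sub hdvd h2
    push_cast at h3
    ring_nf at h3 ⊢
    exact h3
  have h4 : (digitSum p r 0 K : ℤ) < (p : ℤ) ^ K := by exact_mod_cast digitSum_lt hr 0 K
  have h5 : (digitSum p s 0 K : ℤ) < (p : ℤ) ^ K := by exact_mod_cast digitSum_lt hs 0 K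
  have h6 := Int.eq_zero_of_abs_lt_dvd h1 (by rw [abs_lt]; constructor <;> omega)
  omega

/-- Since p may be composite, prime exponents are compared: that of q in o is less than o, hence
less than B, while any prime q dividing o divides p and so has exponent at least B in p ^ B. -/
theorem dvd_pow_of_dvd_pow_of_lt {o p n B : ℕ} (hp : 0 < p) (ho : o ∣ p ^ n) (hB : o < B) :
    o ∣ p ^ B := by
  have ho0 : o ≠ 0 := fun h0 => by
    rw [h0, zero_dvd_iff] at ho
    exact (pow_pos hp n).ne' ho
  rw [← Nat.factorization_prime_le_iff_dvd ho0 (pow_pos hp B).ne']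
  intro q hq
  rw [Nat.factorization_pow, Finsupp.smul_apply, smul_eq_mul]
  by_cases hqo : q ∣ o
  · have h1 : q ∣ p := hq.dvd_of_dvd_pow (hqo.trans ho)
    have h2 := hq.factorization_pos_of_dvd hp.ne' h1
    have h3 := Nat.factorization_lt q ho0
    nlinarith
  · rw [Nat.factorization_eq_zero_of_not_dvd hqo]
    exact Nat.zero_le _

/-- If `p ^ K` divides no `δ n` with `n ≥ K`, then `p ^ n / gcd (δ n, p ^ n)` is unbounded. -/
theorem exists_gcd_mul_le {δ : ℕ → ℤ} (hp : 0 < p) {K : ℕ} (hδ : ∀ n ≥ K, ¬ (p : ℤ) ^ K ∣ δ n)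
    (B : ℕ) : ∃ n ≥ B, Int.gcd (δ n) ((p : ℤ) ^ n) * B ≤ p ^ n := by
  -- If the cofactor o of the gcd d in p ^ (K + B) were below B, it would divide p ^ B. Cancelling p
  -- ^ B then leaves p ^ K dividing d, hence δ (K + B).
  refine ⟨K + B, by omega, ?_⟩
  by_contra! hlt
  set d := Int.gcd (δ (K + B)) ((p : ℤ) ^ (K + B)) with hd
  have h1 : d ∣ p ^ (K + B) := by
    have := Int.gcd_dvd_right (δ (K + B)) ((p : ℤ) ^ (K + B))
    exact_mod_cast this
  obtain ⟨o, ho⟩ := h1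
  have hd0 : 0 < d := by
    rcases Nat.eq_zero_or_pos d with h0 | h0
    · rw [h0, zero_mul] at ho
      exact absurd ho (pow_pos hp _).ne'
    · exact h0
  have h2 : o < B := by
    rw [ho] at hlt
    exact lt_of_mul_lt_mul_left hlt (Nat.zero_le _)
  have h3 : o ∣ p ^ B := dvd_pow_of_dvd_pow_of_lt hp ⟨d, by rw [ho, mul_comm]⟩ h2
  have h4 : p ^ K ∣ d := by
    have h5 : p ^ (K + B) ∣ d * p ^ B := by
      rw [ho]; exact Nat.mul_dvd_mul_left _ h3
    rw [pow_add] at h5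
    exact Nat.dvd_of_mul_dvd_mul_right (pow_pos hp B) h5
  refine hδ (K + B) (by omega) (dvd_trans ?_ (Int.gcd_dvd_left (δ (K + B)) ((p : ℤ) ^ (K + B))))
  rw [← hd]
  exact_mod_cast h4

end Digits

theorem finite_of_period {A : Type*} [Finite A] {e : ℕ} (he : 0 < e) {Y : Set (ℤ → A)}
    (hY : ∀ x ∈ Y, ∀ i, x i = x (i + e)) : Y.Finite := by
  refine Set.Finite.of_injOn (f := fun (x : ℤ → A) (j : Fin e) => x (j : ℕ)) (t := Set.univ)
    (fun _ _ => Set.mem_univ _) ?_ Set.finite_univ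
  intro x hx y hy hxy
  have he' : (0 : ℤ) < e := by exact_mod_cast he
  have hper : ∀ x ∈ Y, ∀ i : ℤ, x i = x (i % e) := by
    intro x hx i
    have h1 : Function.Periodic x (e : ℤ) := fun i => (hY x hx i).symm
    have h2 := h1.int_mul (i / e) (i % e)
    rw [← h2]
    congr 1
    have := Int.emod_add_mul_ediv i e
    push_cast
    linarith [mul_comm (e : ℤ) (i / e)]
  funext i
  rw [hper x hx, hper y hy]
  have h0 := Int.emod_nonneg i he'.ne'
  have h1 := Int.emod_lt_of_pos i he'
  have := congrFun hxy ⟨(i % e).toNat, by omega⟩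
  simpa [Int.toNat_of_nonneg h0] using this

/-! ### Infinite desubstitution -/

section DesubstBasic

variable {A : Type*} [TopologicalSpace A] {τ : A → List A} {p : ℕ}

theorem IsDesubst.eq_inflate {Z : ℕ → ℤ → A} {r : ℕ → ℕ} (hZ : IsDesubst τ p Z r)
    (h : IsConstantLength τ p) (hp : 0 < p) (k m : ℕ) (i : ℤ) :
    Z k i = inflate τ p m (Z (k + m)) (i + (digitSum p r k m : ℕ)) := by
  induction m generalizing i with
  | zero => simp [inflate_zero, digitSum]
  | succ m ih =>
    rw [ih, show Z (k + m) = fun j => inflate τ p 1 (Z (k + m + 1)) (j + (r (k + m) : ℕ)) from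
      funext (hZ.eq (k + m)), inflate_shift hp, ← inflate_add h hp, digitSum_succ]
    congr 1
    push_cast
    ring

/-- The integers `z` such that the `z`-th power of the shift maps `τ ^ n (X_τ)` into itself. -/
def phaseGroup {A : Type*} [TopologicalSpace A] (τ : A → List A) (p n : ℕ) : Set ℤ :=
  {z | ∀ u ∈ substShift τ, ∃ v ∈ substShift τ, ∀ i, inflate τ p n u (i + z) = inflate τ p n v i}

theorem add_mem_phaseGroup {n : ℕ} {z w : ℤ} (hz : z ∈ phaseGroup τ p n)
    (hw : w ∈ phaseGroup τ p n) : z + w ∈ phaseGroup τ p n := by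
  intro u hu
  obtain ⟨v, hv, huv⟩ := hz u hu
  obtain ⟨v', hv', hvv'⟩ := hw v hv
  refine ⟨v', hv', fun i => ?_⟩
  rw [← hvv', ← huv]
  congr 1
  ring

end DesubstBasic

section Desubst

variable {A : Type*} [Finite A] [TopologicalSpace A] [DiscreteTopology A] {τ : A → List A} {p : ℕ}

theorem exists_isDesubst (h : IsConstantLength τ p) (hp : 2 ≤ p)
    (hprim : IsPrimitiveSubst τ) {x : ℤ → A} (hx : x ∈ substShift τ) :
    ∃ (Z : ℕ → ℤ → A) (r : ℕ → ℕ), Z 0 = x ∧ IsDesubst τ p Z r := by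
  have key : ∀ z : substShift τ, ∃ (y : substShift τ) (r : ℕ), r < p ∧
      ∀ i, z.1 i = inflate τ p 1 y.1 (i + (r : ℕ)) := fun z => by
    obtain ⟨y, hy, r, hr, he⟩ := exists_inflate_shift_eq h hp hprim 1 z.2
    exact ⟨⟨y, hy⟩, r, by simpa using hr, he⟩
  choose f g hg hf using key
  let Z : ℕ → substShift τ := fun k => f^[k] ⟨x, hx⟩
  refine ⟨fun k => (Z k).1, fun k => g (Z k), rfl, fun k => (Z k).2, fun k => hg _, fun k i => ?_⟩
  have : Z (k + 1) = f (Z k) := Function.iterate_succ_apply' f k _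
  rw [this]
  exact hf _ i

end Desubst

/-! ### Rigidity of the offsets when the subshift is infinite -/

section Phases

variable {A : Type*} [Finite A] [TopologicalSpace A] [DiscreteTopology A] {τ : A → List A} {p : ℕ}

/-- If some translate of `τ ^ n (X_τ)` meets `τ ^ n (X_τ)`, it is contained in it. -/
theorem mem_phaseGroup (h : IsConstantLength τ p) (hp : 2 ≤ p)
    (hprim : IsPrimitiveSubst τ) {n : ℕ} {z : ℤ} {u v : ℤ → A} (hu : u ∈ substShift τ)
    (hv : v ∈ substShift τ) (huv : ∀ i, inflate τ p n u (i + z) = inflate τ p n v i) :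
    z ∈ phaseGroup τ p n := by
  have hp0 : 0 < p := by omega
  let f : (ℤ → A) → (ℤ → A) := fun y i => inflate τ p n y (i + z)
  have hf : Continuous f :=
    continuous_pi fun i => (continuous_apply (i + z)).comp (continuous_inflate n)
  -- Shifting a point by k shifts its image by k p ^ n, so this closed set is shift-invariant; it
  -- contains u, and minimality makes it all of X_τ.
  let Y : Set (ℤ → A) := substShift τ ∩ f ⁻¹' (inflate τ p n '' substShift τ)
  have hX := isCompact_substShift h hp hprim
  have hcl : IsClosed Y := hX.isClosed.inter ((hX.image (continuous_inflate n)).isClosed.preimage hf)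
  have htr : ∀ (k : ℤ), ∀ w ∈ Y, (fun i => w (i + k)) ∈ Y := by
    rintro k w ⟨hw, y, hy, hwy⟩
    refine ⟨translate_mem_substShift h hp hprim hw k, _,
      translate_mem_substShift h hp hprim hy k, ?_⟩
    funext i
    simp only [f]
    rw [inflate_shift hp0, inflate_shift hp0, hwy]
    simp only [f]
    congr 1
    ring
  have hsub : IsSubshift Y := by
    refine ⟨hcl, Set.Subset.antisymm ?_ ?_⟩
    · rintro _ ⟨w, hw, rfl⟩
      exact htr 1 w hw
    · intro w hw
      refine ⟨_, htr (-1) w hw, ?_⟩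
      funext i
      simp [shiftMap]
  have hXY := substShift_minimal h hp hprim (Y := Y) Set.inter_subset_left
    ⟨u, hu, v, hv, funext fun i => (huv i).symm⟩ hsub
  intro w hw
  obtain ⟨-, y, hy, hwy⟩ := hXY hw
  exact ⟨y, hy, fun i => (congrFun hwy i).symm⟩

/-- The phases form a subgroup of ℤ containing p ^ n, so Bézout applies. Closure under negation
comes from `mem_phaseGroup`: meeting τ ^ n (X_τ) after translation is a symmetric relation. -/
theorem gcd_mem_phaseGroup (h : IsConstantLength τ p) (hp : 2 ≤ p)
    (hprim : IsPrimitiveSubst τ) (hne : (substShift τ).Nonempty) {n : ℕ} {z : ℤ}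
    (hz : z ∈ phaseGroup τ p n) :
    (Int.gcd z ((p : ℤ) ^ n) : ℤ) ∈ phaseGroup τ p n := by
  have hp0 : 0 < p := by omega
  obtain ⟨u, hu⟩ := hne
  have hneg : ∀ w ∈ phaseGroup τ p n, -w ∈ phaseGroup τ p n := by
    intro w hw
    obtain ⟨v, hv, huv⟩ := hw u hu
    refine mem_phaseGroup h hp hprim hv hu fun i => ?_
    rw [← huv]
    congr 1
    ring
  have hzero : (0 : ℤ) ∈ phaseGroup τ p n := fun v hv => ⟨v, hv, fun i => by rw [add_zero]⟩
  let G : AddSubgroup ℤ :=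
    { carrier := phaseGroup τ p n
      add_mem' := fun ha hb => add_mem_phaseGroup ha hb
      zero_mem' := hzero
      neg_mem' := fun ha => hneg _ ha }
  have hP : (p : ℤ) ^ n ∈ G := fun v hv => ⟨_, translate_mem_substShift h hp hprim hv 1, fun i => by
    rw [inflate_shift hp0, one_mul]⟩
  have hz' : z ∈ G := hz
  have : (Int.gcd z ((p : ℤ) ^ n) : ℤ) ∈ G := by
    rw [Int.gcd_eq_gcd_ab, mul_comm z, mul_comm ((p : ℤ) ^ n)]
    exact G.add_mem (by simpa using G.zsmul_mem hz' _) (by simpa using G.zsmul_mem hP _)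
  exact this

/-- A small period of the set `τ ^ n (X_τ)` gives a small period of some word `τ ^ n (c)`. -/
theorem exists_period_letterAt {A : Type*} [Finite A] [TopologicalSpace A] {τ : A → List A} {p : ℕ}
    (hp : 0 < p) (hne : (substShift τ).Nonempty) {n d : ℕ} (hd : 0 < d)
    (hG : (d : ℤ) ∈ phaseGroup τ p n) : ∃ (c : A) (e : ℕ), 0 < e ∧ e ≤ Nat.card A * d ∧
      ∀ i, i + e < p ^ n → letterAt τ n c i = letterAt τ n c (i + e) := by
  obtain ⟨u, hu⟩ := hne
  have hmul : ∀ j : ℕ, ((j * d : ℕ) : ℤ) ∈ phaseGroup τ p n := by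
    intro j
    induction j with
    | zero => exact fun v hv => ⟨v, hv, fun i => by simp⟩
    | succ j ih =>
      have := add_mem_phaseGroup ih hG
      rwa [show ((j + 1) * d : ℕ) = j * d + d by ring, Nat.cast_add]
  choose v hv huv using fun j => hmul j u hu
  cases nonempty_fintype A
  -- Pigeonhole on the letters at the origin of the v j: the block of `inflate τ p n u` starting at
  -- j d is τ ^ n (v j 0), so a repeated letter gives a period (j' - j) d.
  have hcard : Fintype.card A < Fintype.card (Fin (Nat.card A + 1)) := by
    rw [Fintype.card_fin, Nat.card_eq_fintype_card]; omega
  obtain ⟨j, j', hjj, hc⟩ := Fintype.exists_ne_map_eq_of_card_lt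
    (fun j : Fin (Nat.card A + 1) => v j 0) hcard
  have main : ∀ j j' : ℕ, j < j' → j' ≤ Nat.card A → v j 0 = v j' 0 →
      ∃ (c : A) (e : ℕ), 0 < e ∧ e ≤ Nat.card A * d ∧
      ∀ i, i + e < p ^ n → letterAt τ n c i = letterAt τ n c (i + e) := by
    intro j j' hlt hle hc
    refine ⟨v j 0, (j' - j) * d, Nat.mul_pos (by omega) hd, Nat.mul_le_mul_right _ (by omega),
      fun i hi => ?_⟩
    have hb : ∀ (l t : ℕ), t < p ^ n → letterAt τ n (v l 0) t = inflate τ p n u (t + (l * d : ℕ)) := by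
      intro l t ht
      rw [huv, ← inflate_mul_add hp n _ 0 ht]
      simp
    rw [hb j _ hi, hc, hb j' i (by omega)]
    congr 1
    push_cast [Nat.cast_sub hlt.le]
    ring
  rcases lt_or_gt_of_ne (fun hv => hjj (Fin.ext hv) : (j : ℕ) ≠ j') with hlt | hlt
  · exact main j j' hlt (by omega) hc
  · exact main j' j hlt (by omega) hc.symm

/-- When `X_τ` is infinite, the periods of `τ ^ n (X_τ)` cannot be small with respect to
`p ^ n`. -/
theorem exists_bound_of_infinite (h : IsConstantLength τ p) (hp : 2 ≤ p)
    (hprim : IsPrimitiveSubst τ) (hinf : (substShift τ).Infinite) :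
    ∃ B : ℕ, ∀ n ≥ B, ∀ d : ℕ, 0 < d → (d : ℤ) ∈ phaseGroup τ p n → p ^ n < d * B := by
  have hp0 : 0 < p := by omega
  obtain ⟨c, hc⟩ := exists_letterAt_pair h hp hprim
  -- The first term forces the period e to be at most p ^ (n - c); the second ensures c ≤ n.
  refine ⟨Nat.card A * p ^ c + c, fun n hn d hd hG => ?_⟩
  by_contra! hle
  obtain ⟨b, e, he0, he, hper⟩ := exists_period_letterAt hp0 hinf.nonempty hd hG
  obtain ⟨k, rfl⟩ := Nat.exists_eq_add_of_le (show c ≤ n by omega)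
  have hek : e ≤ p ^ k := by
    have h1 : (Nat.card A * d) * p ^ c ≤ p ^ k * p ^ c := by
      rw [pow_add] at hle
      nlinarith [Nat.zero_le (d * c)]
    exact he.trans (Nat.le_of_mul_le_mul_right h1 (by positivity))
  apply hinf
  refine finite_of_period he0 (fun x hx i => ?_)
  obtain ⟨y, hy, r, hr, hxy⟩ :=
    exists_inflate_shift_eq h hp hprim k (translate_mem_substShift h hp hprim hx i)
  obtain ⟨q, hq, hq0, hq1⟩ := hc b y hy
  have hlet : ∀ t < 2 * p ^ k, letterAt τ (c + k) b (q * p ^ k + t) = inflate τ p k y t := by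
    intro t ht
    rw [add_comm c k]
    by_cases htk : t < p ^ k
    · rw [letterAt_add h _ (by omega) htk, hq0, ← inflate_mul_add hp0 k y 0 htk]
      simp
    · obtain ⟨s, rfl⟩ := Nat.exists_eq_add_of_le (not_lt.1 htk)
      rw [show q * p ^ k + (p ^ k + s) = (q + 1) * p ^ k + s by ring,
        letterAt_add h _ hq (by omega), hq1, ← inflate_mul_add hp0 k y 1 (by omega)]
      push_cast
      ring_nf
  -- As r < p ^ k and e ≤ p ^ k, the positions r and r + e both lie in τ ^ k (y 0 y 1), which occurs
  -- inside τ ^ (c + k) (b).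
  have hlt : q * p ^ k + r + e < p ^ (c + k) := by
    rw [pow_add]
    calc q * p ^ k + r + e < q * p ^ k + 2 * p ^ k := by omega
      _ = (q + 2) * p ^ k := by ring
      _ ≤ p ^ c * p ^ k := Nat.mul_le_mul_right _ (by omega)
  have h0 := hxy 0
  have h1 := hxy e
  have h2 := hper (q * p ^ k + r) hlt
  rw [add_assoc, hlet _ (by omega), hlet _ (by omega)] at h2
  simp only [zero_add] at h0
  rw [h0, add_comm i, h1, h2]
  congr 1
  push_cast
  ring

/-- Two points of an infinite `X_τ` that have arbitrarily long common words have the same digits. -/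
theorem IsDesubst.digits_eq (h : IsConstantLength τ p) (hp : 2 ≤ p)
    (hprim : IsPrimitiveSubst τ) (hinf : (substShift τ).Infinite) {Z W : ℕ → ℤ → A} {r s : ℕ → ℕ}
    (hZ : IsDesubst τ p Z r) (hW : IsDesubst τ p W s)
    (hprox : ∀ L : ℕ, ∃ m : ℤ, ∀ i : ℤ, |i| ≤ L → Z 0 (m + i) = W 0 (m + i)) : r = s := by
  have hp0 : 0 < p := by omega
  by_contra hrs
  obtain ⟨K, hK⟩ := exists_not_dvd_digitSum_sub hp0 hZ.lt hW.lt hrs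
  obtain ⟨B, hB⟩ := exists_bound_of_infinite h hp hprim hinf
  obtain ⟨n, hn, hle⟩ := exists_gcd_mul_le
    (δ := fun n => (digitSum p r 0 n : ℤ) - digitSum p s 0 n) hp0 hK B
  refine absurd hle (not_le.2 (hB n hn _ ?_ (gcd_mem_phaseGroup h hp hprim hinf.nonempty ?_)))
  · exact Int.gcd_pos_of_ne_zero_right _ (by positivity)
  set j := digitSum p r 0 n
  set j' := digitSum p s 0 n
  have hX := isCompact_substShift h hp hprim
  -- Agreement on longer and longer windows becomes, in the limit, an exact equality of translates
  -- of two points of τ ^ n (X_τ).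
  let C : ℕ → Set ((ℤ → A) × (ℤ → A)) := fun L => (substShift τ ×ˢ substShift τ) ∩
    {w | ∀ i : ℤ, |i| ≤ L → inflate τ p n w.1 (i + j) = inflate τ p n w.2 (i + j')}
  have hcl : ∀ L, IsClosed (C L) := fun L => by
    refine (hX.isClosed.prod hX.isClosed).inter ?_
    simp only [Set.ofPred_forall]
    refine isClosed_iInter fun i => isClosed_iInter fun _ => isClosed_eq ?_ ?_
    · exact (continuous_apply (i + (j : ℤ))).comp ((continuous_inflate n).comp continuous_fst)
    · exact (continuous_apply (i + (j' : ℤ))).comp ((continuous_inflate n).comp continuous_snd)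
  have hne : ∀ L, (C L).Nonempty := fun L => by
    -- The extra p ^ n pays for recentring the window at the start of a block.
    obtain ⟨m, hm⟩ := hprox (L + p ^ n)
    obtain ⟨q, t, ht, rfl⟩ := exists_eq_mul_pow_add hp0 n m
    refine ⟨(fun i => Z n (i + q), fun i => W n (i + q)),
      ⟨translate_mem_substShift h hp hprim (hZ.mem n) q,
        translate_mem_substShift h hp hprim (hW.mem n) q⟩, fun i hi => ?_⟩
    have h1 := hm (i - t) (by
      have : (t : ℤ) < (p ^ n : ℕ) := by exact_mod_cast ht
      have h3 := abs_sub i t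
      rw [Nat.abs_cast] at h3
      push_cast at this ⊢
      linarith)
    rw [hZ.eq_inflate h hp0 0 n, hW.eq_inflate h hp0 0 n] at h1
    simp only [zero_add] at h1
    simp only [inflate_shift hp0]
    convert h1 using 2 <;> ring
  have hmono : ∀ L, C (L + 1) ⊆ C L := by
    rintro L w ⟨h1, h2⟩
    exact ⟨h1, fun i hi => h2 i (by push_cast; omega)⟩
  obtain ⟨⟨u, v⟩, huv⟩ := IsCompact.nonempty_iInter_of_sequence_nonempty_isCompact_isClosed C hmono
    hne ((hX.prod hX).of_isClosed_subset (hcl 0) Set.inter_subset_left) hcl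
  rw [Set.mem_iInter] at huv
  refine mem_phaseGroup h hp hprim (huv 0).1.1 (huv 0).1.2 fun i => ?_
  have := (huv (i - j').natAbs).2 (i - j') (by simp)
  simp only at this
  convert this using 2 <;> ring

end Phases

/-! ### The word condition in terms of positions -/

section Words

variable {A : Type*} {τ : A → List A} {p : ℕ}

/-- The combinatorial condition on `τ ^ m (a)` and `τ ^ m (b)`, in terms of the positions of the
common pair of letters `a`, `b`, of a coincidence and of a discrepancy. -/
theorem exists_split_iterWord_iff (h : IsConstantLength τ p) (m : ℕ) (a b : A) :
    (∃ u v u' v' : List A, iterWord τ m a = u ++ a :: v ∧ iterWord τ m b = u' ++ b :: v' ∧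
        u.length = u'.length ∧ v.length = v'.length ∧ v ≠ v' ∧ HasCoincidence v v') ↔
    ∃ r q q' : ℕ, r < q ∧ r < q' ∧ q < p ^ m ∧ q' < p ^ m ∧ letterAt τ m a r = a ∧
      letterAt τ m b r = b ∧ letterAt τ m a q = letterAt τ m b q ∧
      letterAt τ m a q' ≠ letterAt τ m b q' := by
  constructor
  · rintro ⟨u, v, u', v', ha, hb, hu, hv, hne, i, c, hi, hi'⟩
    have hla := congrArg List.length ha
    have hlb := congrArg List.length hb
    rw [iterWord_length h, List.length_append, List.length_cons] at hla hlb
    have get_a : ∀ j, j < v.length → v[j]? = some (letterAt τ m a (u.length + 1 + j)) := by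
      intro j hj
      rw [← iterWord_getElem? h (by omega), ha, List.getElem?_append_right (by omega),
        show u.length + 1 + j - u.length = j + 1 by omega, List.getElem?_cons_succ]
    have get_b : ∀ j, j < v.length → v'[j]? = some (letterAt τ m b (u.length + 1 + j)) := by
      intro j hj
      rw [← iterWord_getElem? h (by omega), hb, List.getElem?_append_right (by omega),
        show u.length + 1 + j - u'.length = j + 1 by omega, List.getElem?_cons_succ]
    have hiv : i < v.length := (List.getElem?_eq_some_iff.1 hi).1
    obtain ⟨i', hi'v, hd⟩ : ∃ i' < v.length, v[i']? ≠ v'[i']? := by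
      by_contra! hall
      refine hne (List.ext_getElem? fun j => ?_)
      by_cases hj : j < v.length
      · exact hall j hj
      · rw [List.getElem?_eq_none (by omega), List.getElem?_eq_none (by omega)]
    refine ⟨u.length, u.length + 1 + i, u.length + 1 + i', by omega, by omega, by omega, by omega,
      ?_, ?_, ?_, ?_⟩
    · have := iterWord_getElem? (a := a) h (show u.length < p ^ m by omega)
      rw [ha] at this
      simpa using this.symm
    · have := iterWord_getElem? (a := b) h (show u'.length < p ^ m by omega)
      rw [hb] at this
      rw [hu]
      simpa using this.symm
    · rw [get_a i hiv] at hi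
      rw [get_b i hiv] at hi'
      exact Option.some.inj (hi.trans hi'.symm)
    · rw [get_a i' hi'v, get_b i' hi'v] at hd
      exact fun he => hd (congrArg some he)
  · rintro ⟨r, q, q', hrq, hrq', hq, hq', ha, hb, he, hne⟩
    have split : ∀ c, letterAt τ m c r = c →
        iterWord τ m c = (iterWord τ m c).take r ++ c :: (iterWord τ m c).drop (r + 1) := by
      intro c hc
      have hl : r < (iterWord τ m c).length := by rw [iterWord_length h]; omega
      conv_lhs => rw [← List.take_append_drop r (iterWord τ m c), List.drop_eq_getElem_cons hl]
      congr 2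
      rw [← Option.some_inj, ← List.getElem?_eq_getElem hl, iterWord_getElem? h (by omega), hc]
    have get : ∀ c j, r < j → j < p ^ m →
        ((iterWord τ m c).drop (r + 1))[j - (r + 1)]? = some (letterAt τ m c j) := by
      intro c j hj hjm
      rw [List.getElem?_drop, show r + 1 + (j - (r + 1)) = j by omega, iterWord_getElem? h hjm]
    refine ⟨_, _, _, _, split a ha, split b hb, ?_, ?_, ?_, q - (r + 1), letterAt τ m a q,
      get a q hrq hq, ?_⟩
    · simp only [List.length_take, iterWord_length h]
    · simp only [List.length_drop, iterWord_length h]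
    · intro hvv
      have h1 := get a q' hrq' hq'
      rw [hvv, get b q' hrq' hq'] at h1
      exact hne (Option.some.inj h1).symm
    · rw [get b q hrq hq, he]

end Words

/-! ### From a Li–Yorke pair to the words -/

/-- For some `N₀` and `β`, every bounded part of `[N₀, ∞)` lies in the `β`-th block of level `k`
once `k` is large. -/
theorem exists_block_covering {p : ℕ} (hp : 2 ≤ p) {r : ℕ → ℕ} (hr : ∀ k, r k < p) :
    ∃ β N₀ : ℕ, ∀ N : ℕ, ∃ k₀, ∀ k ≥ k₀, ∀ i, N₀ ≤ i → i < N →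
      β * p ^ k ≤ i + digitSum p r 0 k ∧ i + digitSum p r 0 k < (β + 1) * p ^ k := by
  have hlt := fun k => digitSum_lt hr 0 k
  -- This counts the nonnegative coordinates in block 0 of level k: the blocks at 0 are nested, so
  -- it grows.
  have hmono : Monotone fun k => p ^ k - digitSum p r 0 k := by
    refine monotone_nat_of_le_succ fun k => ?_
    have h1 := hlt k
    have h2 := hr k
    have h3 : digitSum p r 0 (k + 1) = digitSum p r 0 k + p ^ k * r k := by
      rw [digitSum_succ, zero_add]
    have h4 : p ^ k * r k + p ^ k ≤ p ^ (k + 1) := by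
      rw [pow_succ]
      calc p ^ k * r k + p ^ k = p ^ k * (r k + 1) := by ring
        _ ≤ p ^ k * p := Nat.mul_le_mul_left _ h2
    simp only [h3]
    omega
  -- Either block 0 exhausts the right half-line, or its right end stays bounded and block 1, of
  -- length p ^ k, covers everything beyond.
  by_cases hbd : ∀ N, ∃ k, N ≤ p ^ k - digitSum p r 0 k
  · refine ⟨0, 0, fun N => ?_⟩
    obtain ⟨k₀, hk₀⟩ := hbd N
    refine ⟨k₀, fun k hk i _ hi => ⟨by omega, ?_⟩⟩
    have h1 : p ^ k₀ - digitSum p r 0 k₀ ≤ p ^ k - digitSum p r 0 k := hmono hk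
    omega
  · push Not at hbd
    obtain ⟨N₁, hN₁⟩ := hbd
    refine ⟨1, N₁, fun N => ⟨N, fun k hk i hi hiN => ?_⟩⟩
    have h1 := hN₁ k
    have h2 := hlt k
    have h3 : k < p ^ k := Nat.lt_pow_self (by omega)
    omega

section Forward

variable {A : Type*} [Finite A] [TopologicalSpace A] [DiscreteTopology A] {τ : A → List A} {p : ℕ}

/-- The self-reproduction of (a, b) comes from recurrence of the pair of letters at block β. The
discrepancy and the coincidence are fixed at the lower level before the higher one is chosen, so
that its block can reach both. -/
theorem exists_pair_of_agree_of_differ (h : IsConstantLength τ p) (hp : 2 ≤ p)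
    (hprim : IsPrimitiveSubst τ) (hinj : Function.Injective τ) (hinf : (substShift τ).Infinite)
    {x y : ℤ → A} (hx : x ∈ substShift τ) (hy : y ∈ substShift τ)
    (hdiff : ∀ N : ℕ, ∃ i : ℤ, N ≤ i ∧ x i ≠ y i)
    (hprox : ∀ L N : ℕ, ∃ n : ℤ, N ≤ n ∧ ∀ i : ℤ, |i| ≤ L → x (n + i) = y (n + i)) :
    ∃ (m : ℕ) (a b : A), a ≠ b ∧ ∃ r q q' : ℕ, r < q ∧ r < q' ∧ q < p ^ m ∧ q' < p ^ m ∧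
      letterAt τ m a r = a ∧ letterAt τ m b r = b ∧ letterAt τ m a q = letterAt τ m b q ∧
      letterAt τ m a q' ≠ letterAt τ m b q' := by
  have hp0 : 0 < p := by omega
  obtain ⟨Z, r, rfl, hZ⟩ := exists_isDesubst h hp hprim hx
  obtain ⟨W, s, rfl, hW⟩ := exists_isDesubst h hp hprim hy
  obtain rfl : r = s := hZ.digits_eq h hp hprim hinf hW fun L => by
    obtain ⟨n, -, hn⟩ := hprox L 0
    exact ⟨n, hn⟩
  set J := fun k => digitSum p r 0 k with hJ
  have hPk : ∀ k, 0 < p ^ k := fun k => by positivity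
  -- letters of level `k` in terms of letters of level `0`
  have hZ0 : ∀ k i, Z 0 i = inflate τ p k (Z k) (i + (J k : ℕ)) := fun k i => by
    simpa using hZ.eq_inflate h hp0 0 k i
  have hW0 : ∀ k i, W 0 i = inflate τ p k (W k) (i + (J k : ℕ)) := fun k i => by
    simpa using hW.eq_inflate h hp0 0 k i
  have hne_of : ∀ k (i q t : ℕ), i + J k = q * p ^ k + t → t < p ^ k → Z 0 i ≠ W 0 i →
      Z k q ≠ W k q := by
    intro k i q t he ht hne hq
    apply hne
    have he' : (i : ℤ) + (J k : ℕ) = (q : ℤ) * (p : ℤ) ^ k + t := by exact_mod_cast he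
    rw [hZ0 k, hW0 k, he', inflate_mul_add hp0 _ _ _ ht, inflate_mul_add hp0 _ _ _ ht, hq]
  have heq_of : ∀ k (q : ℕ), (∀ t < p ^ k, Z 0 (q * p ^ k + t - J k) = W 0 (q * p ^ k + t - J k)) →
      Z k q = W k q := by
    intro k q hq
    refine eq_of_letterAt_eq h hp0 hinj (n := k) fun t ht => ?_
    have h1 := hq t ht
    rw [hZ0 k, hW0 k, sub_add_cancel, inflate_mul_add hp0 _ _ _ ht,
      inflate_mul_add hp0 _ _ _ ht] at h1
    exact h1
  obtain ⟨β, N₀, hβ⟩ := exists_block_covering hp hZ.lt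
  obtain ⟨t, ht, hxt⟩ := hdiff N₀
  lift t to ℕ using by omega
  replace ht : N₀ ≤ t := by exact_mod_cast ht
  obtain ⟨k₀, hk₀⟩ := hβ (t + 1)
  -- a pair of letters that occurs in the block `β` at infinitely many levels
  obtain ⟨⟨a, b⟩, hab⟩ : ∃ ab : A × A, ∃ᶠ k in atTop, (Z k β, W k β) = ab := by
    by_contra! hall
    obtain ⟨k, hk⟩ := (eventually_all.2 hall).exists
    exact hk _ rfl
  obtain ⟨k₁, hk₁, hab₁⟩ := frequently_atTop.1 hab k₀
  simp only [Prod.mk.injEq] at hab₁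
  have hne : a ≠ b := by
    obtain ⟨h1, h2⟩ := hk₀ k₁ hk₁ t ht (by omega)
    rw [← hab₁.1, ← hab₁.2]
    refine hne_of k₁ t β (t + J k₁ - β * p ^ k₁) ?_ ?_ hxt
    · simp only [hJ]; omega
    · rw [add_mul, one_mul] at h2; simp only [hJ]; omega
  -- a discrepancy and a coincidence at level `k₁`, to the right of the block `β`
  obtain ⟨i', hi', hxi'⟩ := hdiff (N₀ + (β + 1) * p ^ k₁)
  lift i' to ℕ using by omega
  replace hi' : N₀ + (β + 1) * p ^ k₁ ≤ i' := by exact_mod_cast hi'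
  -- This radius makes the window of agreement contain the whole level-k₁ block of n, and the lower
  -- bound on n puts that block to the right of β.
  obtain ⟨n, hn, hxn⟩ := hprox (p ^ k₁) (N₀ + (β + 2) * p ^ k₁)
  lift n to ℕ using by omega
  replace hn : N₀ + (β + 2) * p ^ k₁ ≤ n := by exact_mod_cast hn
  set q' := (i' + J k₁) / p ^ k₁ with hq'
  set q := (n + J k₁) / p ^ k₁ with hq
  have eq' : i' + J k₁ = q' * p ^ k₁ + (i' + J k₁) % p ^ k₁ := by
    rw [mul_comm]; exact (Nat.div_add_mod _ _).symm
  have eq : n + J k₁ = q * p ^ k₁ + (n + J k₁) % p ^ k₁ := by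
    rw [mul_comm]; exact (Nat.div_add_mod _ _).symm
  have hm' := Nat.mod_lt (i' + J k₁) (hPk k₁)
  have hm := Nat.mod_lt (n + J k₁) (hPk k₁)
  have hZq' : Z k₁ q' ≠ W k₁ q' := hne_of k₁ i' q' _ eq' hm' hxi'
  have hs0 : (0 : ℤ) ≤ ((n + J k₁) % p ^ k₁ : ℕ) := Int.natCast_nonneg _
  have hZq : Z k₁ q = W k₁ q := heq_of k₁ q fun t ht => by
    have h1 := hxn ((t : ℤ) - ((n + J k₁) % p ^ k₁ : ℕ)) (by
      rw [abs_le]; constructor <;> omega)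
    have e : (n : ℤ) + ((t : ℤ) - ((n + J k₁) % p ^ k₁ : ℕ)) = q * p ^ k₁ + t - J k₁ := by
      have : ((n + J k₁ : ℕ) : ℤ) = (q * p ^ k₁ + (n + J k₁) % p ^ k₁ : ℕ) := congrArg _ eq
      push_cast at this ⊢
      linarith
    rwa [e] at h1
  have hβq' : β < q' := by
    rw [hq', Nat.lt_iff_add_one_le, Nat.le_div_iff_mul_le (hPk k₁)]; omega
  have hβq : β < q := by
    rw [hq, Nat.lt_iff_add_one_le, Nat.le_div_iff_mul_le (hPk k₁)]
    nlinarith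
  -- all of this lies in the block `β` of a higher level
  obtain ⟨k₀', hk₀'⟩ := hβ (i' + n + 1)
  obtain ⟨k₂, hk₂, hab₂⟩ := frequently_atTop.1 hab (k₀' + k₁ + k₀)
  simp only [Prod.mk.injEq] at hab₂
  obtain ⟨m, rfl⟩ := Nat.exists_eq_add_of_le (show k₁ ≤ k₂ by omega)
  set ρ := digitSum p r k₁ m with hρ
  have hJ2 : J (k₁ + m) = J k₁ + p ^ k₁ * ρ := by
    simp only [hJ, digitSum_add, zero_add, hρ]
  have hcov : ∀ i Q : ℕ, N₀ ≤ i → i < i' + n + 1 → ∀ t < p ^ k₁, i + J k₁ = Q * p ^ k₁ + t →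
      β * p ^ m ≤ Q + ρ ∧ Q + ρ < (β + 1) * p ^ m := by
    intro i Q hi hin t ht he
    obtain ⟨h1, h2⟩ := hk₀' (k₁ + m) (by omega) i hi hin
    have e2 : i + digitSum p r 0 (k₁ + m) = (Q + ρ) * p ^ k₁ + t := by
      have : i + J (k₁ + m) = (Q + ρ) * p ^ k₁ + t := by
        rw [hJ2, ← add_assoc, he]; ring
      exact this
    rw [e2, pow_add] at h1 h2
    constructor
    · have h3 : (β * p ^ m) * p ^ k₁ < (Q + ρ + 1) * p ^ k₁ := by nlinarith
      have := lt_of_mul_lt_mul_right h3 (Nat.zero_le _)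
      omega
    · have h3 : (Q + ρ) * p ^ k₁ < ((β + 1) * p ^ m) * p ^ k₁ := by nlinarith
      exact lt_of_mul_lt_mul_right h3 (Nat.zero_le _)
  -- The coordinate t lies in the block β at level k₁ and in the range covered at level k₁ + m, so
  -- the first block is inside the second.
  have hβc : β * p ^ m ≤ β + ρ ∧ β + ρ < (β + 1) * p ^ m := by
    obtain ⟨h1, h2⟩ := hk₀ k₁ hk₁ t ht (by omega)
    have h1' : β * p ^ k₁ ≤ t + J k₁ := h1
    have h2' : t + J k₁ < (β + 1) * p ^ k₁ := h2
    rw [add_mul, one_mul] at h2'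
    have hti : t < i' + n + 1 := by
      nlinarith
    exact hcov t β ht hti (t + J k₁ - β * p ^ k₁) (by omega) (by omega)
  have hqc := hcov n q (by omega) (by omega) _ hm eq
  have hqc' := hcov i' q' (by omega) (by omega) _ hm' eq'
  have hlev : ∀ (V : ℕ → ℤ → A), IsDesubst τ p V r → ∀ Q : ℕ, β * p ^ m ≤ Q + ρ →
      Q + ρ < (β + 1) * p ^ m → V k₁ Q = letterAt τ m (V (k₁ + m) β) (Q + ρ - β * p ^ m) := by
    intro V hV Q h1 h2
    rw [add_mul, one_mul] at h2
    rw [hV.eq_inflate h hp0 k₁ m, ← inflate_mul_add hp0 m _ _ (by omega)]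
    congr 1
    push_cast [Nat.cast_sub h1]
    ring
  refine ⟨m, a, b, hne, β + ρ - β * p ^ m, q + ρ - β * p ^ m, q' + ρ - β * p ^ m, by omega,
    by omega, ?_, ?_, ?_, ?_, ?_, ?_⟩
  · have := hqc.2; rw [add_mul, one_mul] at this; omega
  · have := hqc'.2; rw [add_mul, one_mul] at this; omega
  · conv_lhs => rw [← hab₂.1]
    rw [← hlev Z hZ β hβc.1 hβc.2, hab₁.1]
  · conv_lhs => rw [← hab₂.2]
    rw [← hlev W hW β hβc.1 hβc.2, hab₁.2]
  · rw [← hab₂.1, ← hab₂.2, ← hlev Z hZ q hqc.1 hqc.2, ← hlev W hW q hqc.1 hqc.2, hZq]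
  · rw [← hab₂.1, ← hab₂.2, ← hlev Z hZ q' hqc'.1 hqc'.2, ← hlev W hW q' hqc'.1 hqc'.2]
    exact hZq'

end Forward

/-! ### From the words to a Li–Yorke pair -/

section Backward

variable {A : Type*} {τ : A → List A} {p : ℕ}

/-- The map `T ^ r ∘ τ ^ m`. -/
def inflateShift (τ : A → List A) (p m r : ℕ) (x : ℤ → A) : ℤ → A :=
  fun i => inflate τ p m x (i + (r : ℕ))

/-- The image of a discrepancy at i lies in the block starting at i p ^ m - r. From i ≥ 1 and r + 2
≤ p ^ m, this start is at least (i - 1) p ^ m + 2 ≥ i + 1, so discrepancies drift to the right. -/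
theorem inflateShift_ne (h : IsConstantLength τ p) (hp : 0 < p) (hinj : Function.Injective τ)
    {m r : ℕ} (hr : r + 2 ≤ p ^ m) {x y : ℤ → A} {i : ℤ} (hi : 1 ≤ i) (hxy : x i ≠ y i) :
    ∃ j ≥ i + 1, inflateShift τ p m r x j ≠ inflateShift τ p m r y j := by
  obtain ⟨t, ht, hne⟩ : ∃ t < p ^ m, letterAt τ m (x i) t ≠ letterAt τ m (y i) t := by
    by_contra! hall
    exact hxy (eq_of_letterAt_eq h hp hinj hall)
  refine ⟨i * (p : ℤ) ^ m + t - r, ?_, ?_⟩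
  · have h1 : (r : ℤ) + 2 ≤ (p : ℤ) ^ m := by exact_mod_cast hr
    nlinarith
  · rw [inflateShift, inflateShift, sub_add_cancel, inflate_mul_add hp _ _ _ ht,
      inflate_mul_add hp _ _ _ ht]
    exact hne

/-- A run of l equal letters becomes a run of l p ^ m, and p ^ m ≥ 2; it drifts right for the same
reason as a discrepancy. -/
theorem inflateShift_eq_on (hp : 0 < p) {m r : ℕ} (hr : r + 2 ≤ p ^ m) {x y : ℤ → A} {i : ℤ}
    {l : ℕ} (hi : 1 ≤ i) (hxy : ∀ j : ℤ, i ≤ j → j < i + l → x j = y j) :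
    ∃ i' ≥ i + 1, ∀ j : ℤ, i' ≤ j → j < i' + (2 * l : ℕ) →
      inflateShift τ p m r x j = inflateShift τ p m r y j := by
  have h1 : (r : ℤ) + 2 ≤ (p : ℤ) ^ m := by exact_mod_cast hr
  refine ⟨i * (p : ℤ) ^ m - r, by nlinarith, fun j hj hjl => ?_⟩
  obtain ⟨q, t, ht, he⟩ := exists_eq_mul_pow_add hp m (j + r)
  rw [inflateShift, inflateShift, he, inflate_mul_add hp _ _ _ ht, inflate_mul_add hp _ _ _ ht]
  have ht' : (t : ℤ) < (p : ℤ) ^ m := by exact_mod_cast ht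
  have hP : (0 : ℤ) < (p : ℤ) ^ m := by positivity
  rw [hxy q]
  · have : i * (p : ℤ) ^ m < (q + 1) * (p : ℤ) ^ m := by linarith
    have := lt_of_mul_lt_mul_right this hP.le
    omega
  · push_cast at hjl
    have h2 : (0 : ℤ) ≤ l * ((p : ℤ) ^ m - 2) := mul_nonneg (by positivity) (by omega)
    have : q * (p : ℤ) ^ m < (i + l) * (p : ℤ) ^ m := by nlinarith
    exact lt_of_mul_lt_mul_right this hP.le

theorem iterate_inflateShift_ne (h : IsConstantLength τ p) (hp : 0 < p)
    (hinj : Function.Injective τ) {m r : ℕ} (hr : r + 2 ≤ p ^ m) (k : ℕ) {x y : ℤ → A} {i : ℤ}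
    (hi : 1 ≤ i) (hxy : x i ≠ y i) :
    ∃ j ≥ i + k, (inflateShift τ p m r)^[k] x j ≠ (inflateShift τ p m r)^[k] y j := by
  induction k with
  | zero => exact ⟨i, by simp, hxy⟩
  | succ k ih =>
    obtain ⟨j, hj, hne⟩ := ih
    obtain ⟨j', hj', hne'⟩ := inflateShift_ne h hp hinj hr (by omega) hne
    refine ⟨j', by push_cast; omega, ?_⟩
    rwa [Function.iterate_succ_apply', Function.iterate_succ_apply']

theorem iterate_inflateShift_eq_on (hp : 0 < p) {m r : ℕ} (hr : r + 2 ≤ p ^ m) (k : ℕ)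
    {x y : ℤ → A} {i : ℤ} (hi : 1 ≤ i) (hxy : x i = y i) :
    ∃ i' ≥ i + k, ∀ j : ℤ, i' ≤ j → j < i' + (2 ^ k : ℕ) →
      (inflateShift τ p m r)^[k] x j = (inflateShift τ p m r)^[k] y j := by
  induction k with
  | zero =>
    refine ⟨i, by simp, fun j h1 h2 => ?_⟩
    obtain rfl : j = i := by push_cast at h2; omega
    exact hxy
  | succ k ih =>
    obtain ⟨i₁, hi₁, heq⟩ := ih
    obtain ⟨i', hi', heq'⟩ := inflateShift_eq_on (τ := τ) hp hr (by omega) heq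
    refine ⟨i', by push_cast; omega, fun j h1 h2 => ?_⟩
    rw [Function.iterate_succ_apply', Function.iterate_succ_apply']
    exact heq' j h1 (by rw [pow_succ, mul_comm] at h2; exact h2)

/-- The pair is taken in the intersection of the nested compact sets Φ ^ k (Q), where Q prescribes a
and b at the origin. Ancestors of every order replace a fixed point. -/
theorem exists_agree_differ_of_pair [Finite A] [TopologicalSpace A] [DiscreteTopology A]
    (h : IsConstantLength τ p) (hp : 2 ≤ p) (hprim : IsPrimitiveSubst τ)
    (hinj : Function.Injective τ) {m : ℕ} {a b : A} {r q q' : ℕ} (hrq : r < q) (hrq' : r < q')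
    (hq : q < p ^ m) (hq' : q' < p ^ m) (ha : letterAt τ m a r = a) (hb : letterAt τ m b r = b)
    (heq : letterAt τ m a q = letterAt τ m b q) (hne : letterAt τ m a q' ≠ letterAt τ m b q') :
    ∃ x ∈ substShift τ, ∃ y ∈ substShift τ,
      (∀ N : ℕ, ∃ i : ℤ, N ≤ i ∧ x i ≠ y i) ∧
      ∀ L N : ℕ, ∃ n : ℤ, N ≤ n ∧ ∀ i : ℤ, |i| ≤ L → x (n + i) = y (n + i) := by
  have hp0 : 0 < p := by omega
  have hX := isCompact_substShift h hp hprim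
  set Φ := inflateShift τ p m r with hΦ
  have hcont : Continuous Φ := continuous_pi fun i =>
    (continuous_apply (i + (r : ℤ))).comp (continuous_inflate m)
  have hΦX : ∀ x ∈ substShift τ, Φ x ∈ substShift τ := fun x hx =>
    translate_mem_substShift h hp hprim (inflate_mem_substShift h hp hprim hx m) _
  have hval : ∀ (x : ℤ → A) (j : ℕ), r ≤ j → j < p ^ m →
      Φ x ((j : ℤ) - r) = letterAt τ m (x 0) j := fun x j _ hj => by
    simp only [hΦ, inflateShift, sub_add_cancel]
    rw [← inflate_mul_add hp0 m x 0 hj]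
    simp
  have hval0 : ∀ x : ℤ → A, Φ x 0 = letterAt τ m (x 0) r := fun x => by
    rw [← hval x r le_rfl (by omega), sub_self]
  let Q : Set ((ℤ → A) × (ℤ → A)) :=
    (substShift τ ∩ {x | x 0 = a}) ×ˢ (substShift τ ∩ {x | x 0 = b})
  have hcl : ∀ c : A, IsClosed {x : ℤ → A | x 0 = c} := fun c =>
    isClosed_eq (continuous_apply 0) continuous_const
  have hQ : IsCompact Q := (hX.inter_right (hcl a)).prod (hX.inter_right (hcl b))
  have hQne : Q.Nonempty := by
    have key : ∀ c : A, (substShift τ ∩ {x | x 0 = c}).Nonempty := fun c => by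
      obtain ⟨x, hx, i, hi⟩ := (substShift_isLeast h hp hprim).1.2 0 c
      refine ⟨_, translate_mem_substShift h hp hprim hx i, ?_⟩
      rw [window_eq_iff _ _ _ _ rfl] at hi
      have := hi 0 (by simp [iterWord])
      simpa [iterWord] using this.symm
    exact (key a).prod (key b)
  have hΨ : Set.MapsTo (Prod.map Φ Φ) Q Q := by
    rintro ⟨x, y⟩ ⟨⟨hx, hxa⟩, hy, hyb⟩
    refine ⟨⟨hΦX x hx, ?_⟩, hΦX y hy, ?_⟩
    · change Φ x 0 = a
      rw [hval0, show x 0 = a from hxa, ha]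
    · change Φ y 0 = b
      rw [hval0, show y 0 = b from hyb, hb]
  let C : ℕ → Set ((ℤ → A) × (ℤ → A)) := fun k => (Prod.map Φ Φ)^[k] '' Q
  have hC : ∀ k, IsCompact (C k) := fun k => hQ.image ((hcont.prodMap hcont).iterate k)
  have hmono : ∀ k, C (k + 1) ⊆ C k := by
    rintro k _ ⟨z, hz, rfl⟩
    exact ⟨_, hΨ hz, by rw [Function.iterate_succ_apply]⟩
  obtain ⟨⟨x, y⟩, hxy⟩ := IsCompact.nonempty_iInter_of_sequence_nonempty_isCompact_isClosed C hmono
    (fun k => hQne.image _) (hC 0) (fun k => (hC k).isClosed)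
  rw [Set.mem_iInter] at hxy
  -- The innermost Φ creates the coincidence at q - r and the discrepancy at q' - r; the other k
  -- applications spread them.
  have hanc : ∀ k, ∃ u v : ℤ → A, u 0 = a ∧ v 0 = b ∧ x = Φ^[k] (Φ u) ∧ y = Φ^[k] (Φ v) := by
    intro k
    obtain ⟨⟨u, v⟩, ⟨⟨-, hu⟩, -, hv⟩, he⟩ := hxy (k + 1)
    rw [Prod.map_iterate, Prod.map_apply, Prod.mk.injEq, Function.iterate_succ_apply,
      Function.iterate_succ_apply] at he
    exact ⟨u, v, hu, hv, he.1.symm, he.2.symm⟩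
  have hr : r + 2 ≤ p ^ m := by
    rcases Nat.lt_or_ge (r + 1) q with h1 | h1
    · omega
    · rcases Nat.lt_or_ge (r + 1) q' with h2 | h2 <;> omega
  have hz : (x, y) ∈ Q := by
    obtain ⟨z, hz, he⟩ := hxy 0
    exact (show z = (x, y) from he) ▸ hz
  refine ⟨x, hz.1.1, y, hz.2.1, fun N => ?_, fun L N => ?_⟩
  · obtain ⟨u, v, hu, hv, rfl, rfl⟩ := hanc N
    obtain ⟨j, hj, hd⟩ := iterate_inflateShift_ne h hp0 hinj hr N (x := Φ u) (y := Φ v)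
      (i := (q' : ℤ) - r) (by omega) (by
        rw [hval _ _ hrq'.le hq', hval _ _ hrq'.le hq', hu, hv]; exact hne)
    exact ⟨j, by omega, hd⟩
  -- With this many iterations the run starts beyond N and its length, a power of 2, exceeds 2 L,
  -- leaving room for a centred window of radius L.
  · obtain ⟨u, v, hu, hv, rfl, rfl⟩ := hanc (N + 2 * L + 1)
    obtain ⟨i', hi', he⟩ := iterate_inflateShift_eq_on (τ := τ) hp0 hr (N + 2 * L + 1) (x := Φ u)
      (y := Φ v) (i := (q : ℤ) - r) (by omega) (by
        rw [hval _ _ hrq.le hq, hval _ _ hrq.le hq, hu, hv]; exact heq)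
    have h2 : N + 2 * L + 1 < 2 ^ (N + 2 * L + 1) := Nat.lt_two_pow_self
    refine ⟨i' + L, by push_cast at hi'; omega, fun i hi => ?_⟩
    rw [abs_le] at hi
    exact he _ (by omega) (by omega)

end Backward

/-! ### Li–Yorke pairs in symbolic terms -/

section Metric

variable {X A : Type*} [MetricSpace X] [CompactSpace X] [TopologicalSpace A] [DiscreteTopology A]
  {f : X → ℤ → A}

/-- Agreement on a finite window is an open condition containing the diagonal, hence an entourage by
compactness. -/
theorem exists_forall_dist_lt_imp_agree (hf : Continuous f) (L : ℕ) :
    ∃ ε > 0, ∀ x y, dist x y < ε → ∀ i : ℤ, |i| ≤ L → f x i = f y i := by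
  have hopen : IsOpen {z : X × X | ∀ i ∈ Finset.Icc (-(L : ℤ)) L, f z.1 i = f z.2 i} := by
    simp only [Set.ofPred_forall]
    refine isOpen_biInter_finset fun i _ => ?_
    have hc : Continuous fun z : X × X => (f z.1 i, f z.2 i) :=
      (((continuous_apply i).comp hf).comp continuous_fst).prodMk
        (((continuous_apply i).comp hf).comp continuous_snd)
    exact (isOpen_discrete {w : A × A | w.1 = w.2}).preimage hc
  have hmem : {z : X × X | ∀ i ∈ Finset.Icc (-(L : ℤ)) L, f z.1 i = f z.2 i} ∈ uniformity X := by
    rw [← nhdsSet_diagonal_eq_uniformity, hopen.mem_nhdsSet]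
    rintro ⟨x, y⟩ hxy
    obtain rfl : x = y := hxy
    exact fun _ _ => rfl
  obtain ⟨ε, hε, h⟩ := Metric.mem_uniformity_dist.1 hmem
  exact ⟨ε, hε, fun x y hxy i hi => h hxy i (Finset.mem_Icc.2 (abs_le.1 hi))⟩

/-- Otherwise the compact sets of pairs at distance at least ε agreeing on growing windows have a
common point, which injectivity of f puts on the diagonal. -/
theorem exists_forall_agree_imp_dist_lt (hf : Continuous f) (hinj : Function.Injective f) {ε : ℝ}
    (hε : 0 < ε) : ∃ L : ℕ, ∀ x y, (∀ i : ℤ, |i| ≤ L → f x i = f y i) → dist x y < ε := by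
  by_contra! hcon
  let K : ℕ → Set (X × X) := fun L =>
    {z | ∀ i : ℤ, |i| ≤ L → f z.1 i = f z.2 i} ∩ {z | ε ≤ dist z.1 z.2}
  have hcl : ∀ L, IsClosed (K L) := fun L => by
    refine IsClosed.inter ?_ (isClosed_le continuous_const continuous_dist)
    simp only [Set.ofPred_forall]
    exact isClosed_iInter fun i => isClosed_iInter fun _ => isClosed_eq
      (((continuous_apply i).comp hf).comp continuous_fst)
      (((continuous_apply i).comp hf).comp continuous_snd)
  have hne : ∀ L, (K L).Nonempty := fun L => by
    obtain ⟨x, y, hxy, hd⟩ := hcon L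
    exact ⟨(x, y), hxy, hd⟩
  have hmono : ∀ L, K (L + 1) ⊆ K L := by
    rintro L z ⟨h1, h2⟩
    exact ⟨fun i hi => h1 i (by push_cast; omega), h2⟩
  obtain ⟨⟨x, y⟩, hxy⟩ := IsCompact.nonempty_iInter_of_sequence_nonempty_isCompact_isClosed K hmono
    hne (hcl 0).isCompact hcl
  rw [Set.mem_iInter] at hxy
  have : x = y := hinj (funext fun i => (hxy i.natAbs).1 i (by simp))
  have h1 : ε ≤ dist x y := (hxy 0).2
  rw [this, dist_self] at h1
  linarith

/-- The Li–Yorke pairs of a system conjugate to a subshift by `f`. -/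
theorem isLiYorkePair_iff_agree_differ (hf : Continuous f) (hinj : Function.Injective f) {T : X → X}
    (hT : ∀ (n : ℕ) x i, f (T^[n] x) i = f x (i + n)) (x y : X) :
    IsLiYorkePair T x y ↔ (∀ N : ℕ, ∃ i : ℤ, N ≤ i ∧ f x i ≠ f y i) ∧
      ∀ L N : ℕ, ∃ n : ℤ, N ≤ n ∧ ∀ i : ℤ, |i| ≤ L → f x (n + i) = f y (n + i) := by
  set u : ℕ → ℝ := fun n => dist (T^[n] x) (T^[n] y) with hu
  obtain ⟨M, hM⟩ : ∃ M : ℝ, ∀ n, u n ≤ M :=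
    ⟨Metric.diam (Set.univ : Set X), fun n =>
      Metric.dist_le_diam_of_mem isCompact_univ.isBounded (Set.mem_univ _) (Set.mem_univ _)⟩
  have hu0 : ∀ n, 0 ≤ u n := fun n => dist_nonneg
  have hba : IsBoundedUnder (· ≤ ·) atTop u := isBoundedUnder_of ⟨M, hM⟩
  have hbb : IsBoundedUnder (· ≥ ·) atTop u := isBoundedUnder_of ⟨0, hu0⟩
  constructor
  · rintro ⟨h1, h2⟩
    constructor
    · intro N
      have hfr := frequently_lt_of_lt_limsup hbb.isCoboundedUnder_le (half_lt_self h1)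
      obtain ⟨L, hL⟩ := exists_forall_agree_imp_dist_lt hf hinj (half_pos h1)
      obtain ⟨n, hn, hlt⟩ := frequently_atTop.1 hfr (N + L)
      have hnot : ¬ ∀ i : ℤ, |i| ≤ L → f (T^[n] x) i = f (T^[n] y) i := fun hall =>
        lt_asymm hlt (hL _ _ hall)
      push Not at hnot
      obtain ⟨i, hi, hne⟩ := hnot
      rw [hT, hT] at hne
      rw [abs_le] at hi
      exact ⟨i + n, by omega, hne⟩
    · intro L N
      obtain ⟨ε, hε, hag⟩ := exists_forall_dist_lt_imp_agree hf L
      have hfr : ∃ᶠ n in atTop, u n < ε :=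
        frequently_lt_of_liminf_lt hba.isCoboundedUnder_ge (by rw [h2]; exact hε)
      obtain ⟨n, hn, hlt⟩ := frequently_atTop.1 hfr N
      refine ⟨n, by exact_mod_cast hn, fun i hi => ?_⟩
      have := hag _ _ hlt i hi
      rwa [hT, hT, add_comm] at this
  · rintro ⟨h1, h2⟩
    constructor
    · obtain ⟨ε, hε, hag⟩ := exists_forall_dist_lt_imp_agree hf 0
      refine lt_of_lt_of_le hε (le_limsup_of_frequently_le (frequently_atTop.2 fun N => ?_) hba)
      obtain ⟨i, hi, hne⟩ := h1 N
      lift i to ℕ using by omega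
      refine ⟨i, by exact_mod_cast hi, not_lt.1 fun hlt => hne ?_⟩
      have := hag _ _ hlt 0 (by simp)
      rwa [hT, hT, zero_add] at this
    · refine le_antisymm (le_of_forall_pos_le_add fun ε hε => ?_)
        (le_liminf_of_le hba.isCoboundedUnder_ge (Eventually.of_forall hu0))
      rw [zero_add]
      obtain ⟨L, hL⟩ := exists_forall_agree_imp_dist_lt hf hinj hε
      refine liminf_le_of_frequently_le (frequently_atTop.2 fun N => ?_) hbb
      obtain ⟨n, hn, hag⟩ := h2 L N
      lift n to ℕ using by omega
      refine ⟨n, by exact_mod_cast hn, (hL _ _ fun i hi => ?_).le⟩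
      rw [hT, hT, add_comm]
      exact hag i hi

end Metric

theorem proposition3p5 {A : Type*} [Finite A] [TopologicalSpace A] [DiscreteTopology A]
    (τ : A → List A) (p : ℕ) (hp : 2 ≤ p) (hlen : IsConstantLength τ p)
    (hprim : IsPrimitiveSubst τ) (hinj : Function.Injective τ)
    (hinf : (substShift τ).Infinite)
    -- any metric inducing on `X_τ` its topology as a subspace of the product `A ^ ℤ`
    [ρ : MetricSpace (substShift τ)]
    (hρ : ρ.toPseudoMetricSpace.toUniformSpace.toTopologicalSpace =
      (instTopologicalSpaceSubtype : TopologicalSpace (substShift τ))) :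
    (∃ x y : substShift τ, IsLiYorkePair (substShiftMap τ) x y) ↔
      ∃ (m : ℕ) (a b : A) (u v u' v' : List A), a ≠ b ∧
        iterWord τ m a = u ++ a :: v ∧ iterWord τ m b = u' ++ b :: v' ∧
        u.length = u'.length ∧ v.length = v'.length ∧ v ≠ v' ∧ HasCoincidence v v' := by
  have hcpt : @CompactSpace (substShift τ)
      ρ.toPseudoMetricSpace.toUniformSpace.toTopologicalSpace := by
    rw [hρ]
    exact isCompact_iff_compactSpace.1 (isCompact_substShift hlen hp hprim)
  have hf : @Continuous (substShift τ) (ℤ → A)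
      ρ.toPseudoMetricSpace.toUniformSpace.toTopologicalSpace _ Subtype.val := by
    rw [hρ]
    exact continuous_subtype_val
  have hT : ∀ (n : ℕ) (x : substShift τ) (i : ℤ),
      ((substShiftMap τ)^[n] x).1 i = x.1 (i + n) := by
    intro n
    induction n with
    | zero => simp
    | succ n ih =>
      intro x i
      rw [Function.iterate_succ_apply, ih]
      change x.1 (i + n + 1) = _
      push_cast
      ring_nf
  have hiff := isLiYorkePair_iff_agree_differ hf Subtype.val_injective hT
  constructor
  · rintro ⟨x, y, hxy⟩
    obtain ⟨hdiff, hprox⟩ := (hiff x y).1 hxy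
    obtain ⟨m, a, b, hab, hpos⟩ :=
      exists_pair_of_agree_of_differ hlen hp hprim hinj hinf x.2 y.2 hdiff hprox
    obtain ⟨u, v, u', v', hw⟩ := (exists_split_iterWord_iff hlen m a b).2 hpos
    exact ⟨m, a, b, u, v, u', v', hab, hw⟩
  · rintro ⟨m, a, b, u, v, u', v', -, hw⟩
    obtain ⟨r, q, q', hrq, hrq', hq, hq', ha, hb, heq, hne⟩ :=
      (exists_split_iterWord_iff hlen m a b).1 ⟨u, v, u', v', hw⟩
    obtain ⟨x, hx, y, hy, hxy⟩ := exists_agree_differ_of_pair hlen hp hprim hinj hrq hrq' hq hq'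
      ha hb heq hne
    exact ⟨⟨x, hx⟩, ⟨y, hy⟩, (hiff ⟨x, hx⟩ ⟨y, hy⟩).2 hxy⟩
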